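/- Let $E$ be a complex and $F$ a real finite-dimensional Hilbert space, $n=\dim_{\mathbb C}E$, $m=\dim_{\mathbb R}F$, and let $\Phi\colon E\times E\to F_{\mathbb C}$ be a hermitian map (linear in the first variable, antilinear in the second, $\Phi(\zeta',\zeta)=\overline{\Phi(\zeta,\zeta')}$), for example the one defining a homogeneous Siegel domain of type II. Let $\mathcal N=E\times F$ be the group with product $(\zeta,x)(\zeta',x')=(\zeta+\zeta',\,x+x'+2\operatorname{Im}\Phi(\zeta,\zeta'))$, endowed with a Haar (Lebesgue) measure, and put $Q=n+m$. Let $d$ be the left-invariant control distance on $\mathcal N$: $d(z,z')$ is the infimum of the $\varepsilon>0$ for which there is an absolutely continuous curve $\gamma\colon[0,1]\to\mathcal N$ from $z$ to $z'$ such that, almost everywhere, the components $a\in E$, $b\in F$ of $\gamma'$ in the left-invariant frame (so that $\gamma'=(a,\,b+2\operatorname{Im}\Phi(\gamma_E,a))$, with $\gamma_E$ the $E$-component of $\gamma$) satisfy $|a|\le\varepsilon$ and $|b|^{1/2}\le\varepsilon$. Let $B$ and $\overline B$ denote the open and closed balls for $d$. A family $(z_j)_{j\in J}$ in $\mathcal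 N$ is a $(\delta,R)$-lattice if the balls $B(z_j,\delta)$ are pairwise disjoint and the balls $B(z_j,R\delta)$ cover $\mathcal N$. For a Schwartz function $\varphi$ on $\mathcal N$, let $\mathcal O(\varphi)$ be the space of tempered distributions $u$ on $\mathcal N$ with $u=u*\varphi$, where $(u*\varphi)(z)=\langle u,\varphi((\,\cdot\,)^{-1}z)\rangle$; such a $u$ is identified with the function $u*\varphi$. For $p\in\,]0,\infty]$ let $\mathcal O^p(\varphi)=\mathcal O(\varphi)\cap L^p(\mathcal N)$. Theorem (sampling). Let $\varphi$ be a Schwartz function on $\mathcal N$, $p\in\,]0,\infty]$, $\delta_+>0$ and $R_0>1$. Then there are $C,\delta_->0$ such that, for every $(\delta,R)$-lattice $(z_j)_{j\in J}$ on $\mathcal N$ with $\delta>0$ and $R\in\,]1,R_0]$, and for every $u\in\mathcal O(\varphi)$, $$\frac1C\|u\|_{L^p(\mathcal N)}\le\delta^{2Q/p}\Big\|\max_{\overline B(z_j,R\delta)}|u|\Big\|_{\ell^p(J)}\le C\|u\|_{L^p(\mathcal N)}\qquad\text{if }\delta\le\delta_+,$$ and $$\frac1C\|u\|_{L^p(\mathcal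 N)}\le\delta^{2Q/p}\Big\|\min_{\overline B(z_j,R\delta)}|u|\Big\|_{\ell^p(J)}\le C\|u\|_{L^p(\mathcal N)}\qquad\text{if }\delta\le\delta_-\text{ and }u\in\mathcal O^p(\varphi).$$ Here all norms take values in $[0,\infty]$, and $2Q/p=0$ if $p=\infty$. -/

import Mathlib

open MeasureTheory SchwartzMap TensorProduct
open scoped ENNReal

noncomputable section

namespace Sampling

/-! ### Complexification and hermitian maps

`ℂ ⊗[ℝ] F` is the complexification of the real vector space `F`. -/

section Complexification

variable (F : Type*) [AddCommGroup F] [Module ℝ F]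

/-- Conjugation on the complexification of `F`: `c ⊗ x ↦ conj c ⊗ x`. -/
def conjC : (ℂ ⊗[ℝ] F) →ₗ[ℝ] (ℂ ⊗[ℝ] F) :=
  LinearMap.rTensor F (Complex.conjAe.toLinearMap)

/-- Imaginary part on the complexification of `F`: `c ⊗ x ↦ (Im c) x`. -/
def imC : (ℂ ⊗[ℝ] F) →ₗ[ℝ] F :=
  (TensorProduct.lid ℝ F).toLinearMap ∘ₗ LinearMap.rTensor F Complex.imLm

end Complexification

/-- A hermitian map `E × E → F_ℂ`: complex linear in the first variable, antilinear in the second,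
and such that exchanging the variables amounts to conjugating the value. -/
structure HermitianMap (E F : Type*) [AddCommGroup E] [Module ℂ E]
    [AddCommGroup F] [Module ℝ F] where
  /-- The underlying sesquilinear map. -/
  toSesq : E →ₗ[ℂ] E →ₗ⋆[ℂ] (ℂ ⊗[ℝ] F)
  conj_symm : ∀ ζ ζ' : E, toSesq ζ' ζ = conjC F (toSesq ζ ζ')

lemma imC_conjC {F : Type*} [AddCommGroup F] [Module ℝ F] (z : ℂ ⊗[ℝ] F) :
    imC F (conjC F z) = -imC F z := by
  induction z with
  | zero => simp
  | tmul c x => simp [imC, conjC]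
  | add a b ha hb => rw [map_add, map_add, ha, hb, map_add, neg_add]

/-! ### The group -/

section Group

variable {E F : Type*} [NormedAddCommGroup E] [InnerProductSpace ℂ E]
  [NormedAddCommGroup F] [InnerProductSpace ℝ F]

/-- `Im Φ(ζ, ζ')`. -/
def HermitianMap.im (Φ : HermitianMap E F) (ζ ζ' : E) : F := imC F (Φ.toSesq ζ ζ')

lemma HermitianMap.im_add_left (Φ : HermitianMap E F) (a b c : E) :
    Φ.im (a + b) c = Φ.im a c + Φ.im b c := by simp [HermitianMap.im]

lemma HermitianMap.im_add_right (Φ : HermitianMap E F) (a b c : E) :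
    Φ.im a (b + c) = Φ.im a b + Φ.im a c := by simp [HermitianMap.im]

lemma HermitianMap.im_neg_left (Φ : HermitianMap E F) (a b : E) :
    Φ.im (-a) b = -Φ.im a b := by simp [HermitianMap.im]

lemma HermitianMap.im_smul_left (Φ : HermitianMap E F) (t : ℝ) (a b : E) :
    Φ.im (t • a) b = t • Φ.im a b := by simp [HermitianMap.im]

lemma HermitianMap.im_swap (Φ : HermitianMap E F) (a b : E) : Φ.im b a = -Φ.im a b := by
  rw [HermitianMap.im, Φ.conj_symm, imC_conjC, HermitianMap.im]

lemma HermitianMap.im_self (Φ : HermitianMap E F) (a : E) : Φ.im a a = 0 := by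
  have h := Φ.im_swap a a
  have h2 : (2 : ℝ) • Φ.im a a = 0 := by rw [two_smul]; nth_rewrite 1 [h]; simp
  exact (smul_eq_zero.mp h2).resolve_left two_ne_zero

/-- The product `(ζ, x)(ζ', x') = (ζ + ζ', x + x' + 2 Im Φ(ζ, ζ'))` on `E × F`. -/
def nMul (Φ : HermitianMap E F) (z z' : E × F) : E × F :=
  (z.1 + z'.1, z.2 + z'.2 + (2 : ℝ) • Φ.im z.1 z'.1)

/-- The inverse `(ζ, x)⁻¹ = (-ζ, -x)` for the product `nMul`. -/
def nInv (z : E × F) : E × F := (-z.1, -z.2)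

/-- The group axioms for `nMul` and `nInv`; the identity is `(0, 0)`. -/
lemma nMul_group (Φ : HermitianMap E F) :
    (∀ a b c : E × F, nMul Φ (nMul Φ a b) c = nMul Φ a (nMul Φ b c)) ∧
    (∀ a : E × F, nMul Φ 0 a = a) ∧ (∀ a : E × F, nMul Φ (nInv a) a = 0) := by
  refine ⟨fun a b c => ?_, fun a => ?_, fun a => ?_⟩
  · ext
    · simp [nMul, add_assoc]
    · simp only [nMul, Φ.im_add_left, Φ.im_add_right, smul_add]; abel
  · ext <;> simp [nMul, HermitianMap.im]
  · ext <;> simp [nMul, nInv, Φ.im_neg_left, Φ.im_self]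

/-! ### The control distance and lattices -/

/-- `γ` is an absolutely continuous curve on `[0, 1]` such that, almost everywhere, the components
`a` (in `E`) and `b` (in `F`) of its velocity with respect to the left-invariant frame satisfy
`|a| ≤ ε` and `|b|^{1/2} ≤ ε`. At `(ζ, x)`, the left-invariant vector field with value `(a, b)` at
the identity has the value `(a, b + 2 Im Φ(ζ, a))`. -/
def IsAdmissibleCurve (Φ : HermitianMap E F) (ε : ℝ) (γ : ℝ → E × F) : Prop :=
  AbsolutelyContinuousOnInterval γ 0 1 ∧
  ∀ᵐ s ∂(volume.restrict (Set.Icc (0 : ℝ) 1)), ∃ (a : E) (b : F),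
    HasDerivAt γ (a, b + (2 : ℝ) • Φ.im (γ s).1 a) s ∧ ‖a‖ ≤ ε ∧ Real.sqrt ‖b‖ ≤ ε

/-- The left-invariant, `(1/2)`-homogeneous control distance on `E × F`. -/
def ctrlDist (Φ : HermitianMap E F) (z z' : E × F) : ℝ :=
  sInf {ε : ℝ | 0 < ε ∧ ∃ γ : ℝ → E × F, γ 0 = z ∧ γ 1 = z' ∧ IsAdmissibleCurve Φ ε γ}

/-- `(x_j)` is a `(δ, R)`-lattice for the distance `d`: the balls `B(x_j, δ)` are pairwise disjoint
and the balls `B(x_j, R δ)` cover the space. -/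
def IsLattice {X J : Type*} (d : X → X → ℝ) (δ R : ℝ) (x : J → X) : Prop :=
  (Pairwise fun j k => Disjoint {y | d (x j) y < δ} {y | d (x k) y < δ}) ∧
  ∀ y, ∃ j, d (x j) y < R * δ

/-- The maximum of `|f|` over the closed ball of centre `x` and radius `r` (with respect to the
distance `d`), as an element of `[0, ∞]`; closed balls of `ctrlDist` are compact, so that for a
continuous `f` the supremum is attained. -/
def ballMax {X : Type*} (d : X → X → ℝ) (f : X → ℂ) (x : X) (r : ℝ) : ℝ≥0∞ :=
  ⨆ y ∈ {y | d x y ≤ r}, ‖f y‖ₑ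

/-- The minimum of `|f|` over the closed ball of centre `x` and radius `r`. -/
def ballMin {X : Type*} (d : X → X → ℝ) (f : X → ℂ) (x : X) (r : ℝ) : ℝ≥0∞ :=
  ⨅ y ∈ {y | d x y ≤ r}, ‖f y‖ₑ

/-- The `ℓ^p` (quasi-)norm, `0 < p ≤ ∞`, of a family of elements of `[0, ∞]`. -/
def ellNorm {J : Type*} (p : ℝ≥0∞) (a : J → ℝ≥0∞) : ℝ≥0∞ :=
  if p = ∞ then ⨆ j, a j else (∑' j, a j ^ p.toReal) ^ (1 / p.toReal)

/-! ### Convolution of tempered distributions and Schwartz functions -/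

variable [FiniteDimensional ℂ E] [FiniteDimensional ℝ F]

/-- The linear part of the affine bijection `y ↦ y⁻¹ x` of `E × F`. -/
def reflLin (Φ : HermitianMap E F) (x : E × F) : (E × F) ≃ₗ[ℝ] (E × F) where
  toFun y := (-y.1, -y.2 - (2 : ℝ) • Φ.im y.1 x.1)
  invFun y := (-y.1, -y.2 + (2 : ℝ) • Φ.im y.1 x.1)
  map_add' y y' := by
    ext
    · simp only [Prod.fst_add, neg_add]
    · simp only [Prod.fst_add, Prod.snd_add, Φ.im_add_left, smul_add]; abel
  map_smul' t y := by
    ext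
    · simp
    · simp only [Prod.smul_fst, Prod.smul_snd, Φ.im_smul_left, RingHom.id_apply, smul_sub,
        smul_neg, smul_comm t (2 : ℝ)]
  left_inv y := by ext <;> simp [Φ.im_neg_left]
  right_inv y := by ext <;> simp [Φ.im_neg_left]

/-- The Schwartz function `y ↦ φ(y⁻¹ x)`. -/
def reflTranslate (Φ : HermitianMap E F) (φ : 𝓢(E × F, ℂ)) (x : E × F) : 𝓢(E × F, ℂ) :=
  SchwartzMap.compCLMOfContinuousLinearEquiv ℂ (reflLin Φ x).toContinuousLinearEquiv
    (SchwartzMap.compSubConstCLM ℂ (-x) φ)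

lemma reflTranslate_apply (Φ : HermitianMap E F) (φ : 𝓢(E × F, ℂ)) (x y : E × F) :
    reflTranslate Φ φ x y = φ (nMul Φ (nInv y) x) := by
  have h : reflTranslate Φ φ x y = φ (reflLin Φ x y - -x) := rfl
  rw [h]
  congr 1
  ext
  · simp [reflLin, nMul, nInv]
  · simp only [reflLin, nMul, nInv, Φ.im_neg_left, LinearEquiv.coe_mk, LinearMap.coe_mk,
      AddHom.coe_mk, Prod.snd_sub, Prod.snd_neg, smul_neg]
    abel

/-- The function `(u * φ)(x) = ⟨u, φ((·)⁻¹ x)⟩` on `E × F`. -/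
def conv (Φ : HermitianMap E F) (u : 𝓢'(E × F, ℂ)) (φ : 𝓢(E × F, ℂ)) (x : E × F) : ℂ :=
  u (reflTranslate Φ φ x)

variable [MeasurableSpace E] [MeasurableSpace F]

/-- The space `O(φ)` of the tempered distributions `u` with `u = u * φ`: the distribution `u` is
integration, with respect to `μ`, against the function `u * φ`, with which it is identified. -/
def spaceO (Φ : HermitianMap E F) (μ : Measure (E × F)) (φ : 𝓢(E × F, ℂ)) :
    Set (𝓢'(E × F, ℂ)) :=
  {u | ∀ τ : 𝓢(E × F, ℂ), u τ = ∫ x, conv Φ u φ x * τ x ∂μ}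

/-- The space `O^p(φ)` of the elements of `O(φ)` which belong to `L^p(μ)`. -/
def spaceOp (Φ : HermitianMap E F) (μ : Measure (E × F)) (φ : 𝓢(E × F, ℂ)) (p : ℝ≥0∞) :
    Set (𝓢'(E × F, ℂ)) :=
  {u | u ∈ spaceO Φ μ φ ∧ MemLp (conv Φ u φ) p μ}

end Group

end Sampling

end

/-!
Sampling theorem for functions reproduced by convolution with a Schwartz function on the group
`E × F`.

Testing the identity `u = u * φ` against the translates of `φ` gives the reproducing formula
`u(w) = ∫ u(y) φ(y⁻¹ w) dy` (`conv_eq_integral`), legitimate since `u * φ` is continuous and has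
polynomial growth (`continuous_conv`, `norm_conv_le`). As `φ` and its right differences decay
rapidly, all the information about `u` near a point `z` is contained in the average
`H(z) = ∫ |u(y)| (1 + ‖y⁻¹ z‖)^{-M} dy` (`avg`): up to constants, `|u| ≤ H(z)` on a bounded
neighbourhood of `z`, and `|u(z g) - u(z)| ≤ ‖g‖ H(z)` for bounded `g` (`exists_dominating`). The
weight `1 + ‖v‖` is submultiplicative on the group up to a constant, so that changing the centre
`z` is harmless.

The `L^p` norm of `H` is controlled by that of `u`. For `p ≥ 1` this is Jensen's inequality and
Tonelli's theorem (`eLpNorm_avg_le_of_one_le`). For `p < 1`, one writes `|u| = |u|^p |u|^{1-p}` in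
the integral and bounds the last factor by `H(z)^{1-p}` times a power of the weight, so that
`H(z) ≤ C H(z)^{1-p} ∫ |u(y)|^p (1 + ‖y⁻¹ z‖)^{-Mp} dy`. If `H(z)` is finite, then one may divide by
`H(z)^{1-p}` (`avg_rpow_le`) and integrate. Finiteness is obtained by first taking `M` larger than
the order of growth of `u`, which shows that an element of `L^p` is bounded
(`eLpNorm_avg_le_of_le_one`).

The control distance is comparable to `max (|ζ|, |x|^{1/2})` evaluated at `z⁻¹ z'`
(`ctrlDist_le_homNorm`, `homNorm_le_ctrlDist`), so that the balls of a lattice lie between disjoint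
homogeneous balls and larger homogeneous balls covering the group, all of measure proportional to
`δ^{2Q}`. Comparing sums over the lattice with integrals over these balls (`ellNorm_le_eLpNorm`,
`eLpNorm_stepSup_le`) gives the estimates for the maxima. For the minima,
`|u| ≤ min |u| + C δ H` on each ball, and the error term `C δ ‖H‖ ≤ C' δ ‖u‖` is absorbed by the
left-hand side when `δ` is small, since `‖u‖` is finite.
-/

set_option linter.unusedSectionVars false

namespace Sampling

/-! ### Algebra in the group -/

section Group

variable {E F : Type*} [NormedAddCommGroup E] [InnerProductSpace ℂ E]
  [NormedAddCommGroup F] [InnerProductSpace ℝ F]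

lemma HermitianMap.im_smul_right (Φ : HermitianMap E F) (t : ℝ) (a b : E) :
    Φ.im a (t • b) = t • Φ.im a b := by
  rw [Φ.im_swap, Φ.im_smul_left, Φ.im_swap a b, smul_neg, neg_neg]

lemma HermitianMap.im_neg_right (Φ : HermitianMap E F) (a b : E) :
    Φ.im a (-b) = -Φ.im a b := by
  rw [Φ.im_swap, Φ.im_neg_left, Φ.im_swap b a]

lemma HermitianMap.im_sub_left (Φ : HermitianMap E F) (a b c : E) :
    Φ.im (a - b) c = Φ.im a c - Φ.im b c := by
  rw [sub_eq_add_neg, Φ.im_add_left, Φ.im_neg_left, sub_eq_add_neg]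

lemma nMul_nInv_nMul (Φ : HermitianMap E F) (z w : E × F) :
    nMul Φ z (nMul Φ (nInv z) w) = w := by
  ext
  · simp [nMul, nInv]
  · simp [nMul, nInv, Φ.im_add_right, Φ.im_neg_left, Φ.im_neg_right, Φ.im_self]
    abel

lemma nInv_nMul_nMul (Φ : HermitianMap E F) (z w : E × F) :
    nMul Φ (nInv z) (nMul Φ z w) = w := by
  ext
  · simp [nMul, nInv]
  · simp [nMul, nInv, Φ.im_add_right, Φ.im_neg_left, Φ.im_self]
    abel

lemma nInv_nMul (Φ : HermitianMap E F) (z w : E × F) :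
    nInv (nMul Φ z w) = nMul Φ (nInv w) (nInv z) := by
  ext
  · simp [nMul, nInv, add_comm]
  · simp only [nMul, nInv, Φ.im_neg_left, Φ.im_neg_right, neg_neg, Φ.im_swap z.1 w.1, smul_neg]
    abel

lemma nMul_assoc (Φ : HermitianMap E F) (a b c : E × F) :
    nMul Φ (nMul Φ a b) c = nMul Φ a (nMul Φ b c) := (nMul_group Φ).1 a b c

variable [FiniteDimensional ℂ E]

/-- `Im Φ` as a continuous real bilinear map. -/
noncomputable def HermitianMap.imCLM (Φ : HermitianMap E F) : E →L[ℝ] E →L[ℝ] F :=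
  haveI : FiniteDimensional ℝ E := FiniteDimensional.complexToReal E
  (LinearMap.mk₂ ℝ Φ.im Φ.im_add_left Φ.im_smul_left Φ.im_add_right
    Φ.im_smul_right).toContinuousBilinearMap

lemma HermitianMap.imCLM_apply (Φ : HermitianMap E F) (a b : E) : Φ.imCLM a b = Φ.im a b := rfl

lemma HermitianMap.norm_im_le (Φ : HermitianMap E F) (a b : E) :
    ‖Φ.im a b‖ ≤ ‖Φ.imCLM‖ * ‖a‖ * ‖b‖ := Φ.imCLM.le_opNorm₂ a b

end Group

/-! ### Absolutely continuous curves -/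

lemma _root_.AbsolutelyContinuousOnInterval.lipschitz_comp {X Y : Type*} [PseudoMetricSpace X]
    [PseudoMetricSpace Y] {K : NNReal} {g : X → Y} (hg : LipschitzWith K g) {f : ℝ → X} {a b : ℝ}
    (hf : AbsolutelyContinuousOnInterval f a b) :
    AbsolutelyContinuousOnInterval (fun s => g (f s)) a b := by
  rw [absolutelyContinuousOnInterval_iff] at hf ⊢
  intro ε hε
  obtain ⟨δ, hδ, h⟩ := hf (ε / (K + 1)) (by positivity)
  refine ⟨δ, hδ, fun I hI hlt => ?_⟩
  have h1 := h I hI hlt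
  rw [lt_div_iff₀ (by positivity)] at h1
  refine lt_of_le_of_lt ?_ h1
  rw [Finset.sum_mul]
  refine Finset.sum_le_sum fun i _ => (hg.dist_le_mul _ _).trans ?_
  nlinarith [dist_nonneg (x := f (I.2 i).1) (y := f (I.2 i).2)]

/-- A mean value inequality for absolutely continuous curves; composing with a norming functional
reduces it to the fundamental theorem of calculus for real-valued functions. -/
lemma _root_.AbsolutelyContinuousOnInterval.norm_sub_le {V : Type*} [NormedAddCommGroup V]
    [NormedSpace ℝ V] {f : ℝ → V} {c : ℝ} (hc : 0 ≤ c) (hf : AbsolutelyContinuousOnInterval f 0 1)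
    (hd : ∀ᵐ s ∂(volume.restrict (Set.Icc (0 : ℝ) 1)), ∃ v, HasDerivAt f v s ∧ ‖v‖ ≤ c)
    {t : ℝ} (ht : t ∈ Set.Icc (0 : ℝ) 1) : ‖f t - f 0‖ ≤ c := by
  obtain ⟨g, hg, hgv⟩ := exists_dual_vector'' ℝ (f t - f 0)
  have hac : AbsolutelyContinuousOnInterval (fun s => g (f s)) 0 t := by
    refine (hf.lipschitz_comp g.lipschitz).mono ?_
    rw [Set.uIcc_of_le ht.1, Set.uIcc_of_le zero_le_one]
    exact Set.Icc_subset_Icc_right ht.2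
  have h1 := hac.integral_deriv_eq_sub
  have h2 : ‖∫ s in (0 : ℝ)..t, deriv (fun s => g (f s)) s‖ ≤ c * |t - 0| := by
    refine intervalIntegral.norm_integral_le_of_norm_le_const_ae ?_
    rw [ae_restrict_iff' measurableSet_Icc] at hd
    filter_upwards [hd] with s hs hst
    rw [Set.uIoc_of_le ht.1] at hst
    obtain ⟨v, hv, hvc⟩ := hs ⟨hst.1.le, hst.2.trans ht.2⟩
    have hgd : deriv (fun s => g (f s)) s = g v := (g.hasFDerivAt.comp_hasDerivAt s hv).deriv
    rw [hgd]
    calc ‖g v‖ ≤ ‖g‖ * ‖v‖ := g.le_opNorm v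
      _ ≤ 1 * c := by gcongr
      _ = c := one_mul c
  rw [h1, ← map_sub, hgv] at h2
  rw [sub_zero, abs_of_nonneg ht.1] at h2
  have h3 : ‖f t - f 0‖ ≤ c * t := by simpa using h2
  nlinarith [ht.2]

/-! ### The homogeneous norm -/

section Norm

variable {E F : Type*} [NormedAddCommGroup E] [NormedAddCommGroup F]

lemma nInv_eq_neg (z : E × F) : nInv z = -z := rfl

/-- The homogeneous norm `max (|ζ|, |x|^{1/2})` on `E × F`; it is homogeneous of degree one for the
dilations `(ζ, x) ↦ (r ζ, r² x)`. -/
noncomputable def homNorm (h : E × F) : ℝ := max ‖h.1‖ (Real.sqrt ‖h.2‖)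

lemma homNorm_nonneg (h : E × F) : 0 ≤ homNorm h := le_max_of_le_left (norm_nonneg _)

lemma continuous_homNorm : Continuous (homNorm : E × F → ℝ) := by
  unfold homNorm; fun_prop

end Norm

/-! ### Comparison of the control distance with a homogeneous norm -/

section Comparison

variable {E F : Type*} [NormedAddCommGroup E] [InnerProductSpace ℂ E]
  [NormedAddCommGroup F] [InnerProductSpace ℝ F]

/-- The ball of centre `z` and radius `r` for the left-invariant quasi-distance associated with the
homogeneous norm. -/
def homBall (Φ : HermitianMap E F) (z : E × F) (r : ℝ) : Set (E × F) :=
  {y | homNorm (nMul Φ (nInv z) y) < r}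

lemma mem_homBall_self (Φ : HermitianMap E F) (z : E × F) {r : ℝ} (hr : 0 < r) :
    z ∈ homBall Φ z r := by
  have : nMul Φ (nInv z) z = 0 := (nMul_group Φ).2.2 z
  simpa [homBall, this, homNorm] using hr

/-- The curve `s ↦ z · (s h)` joins `z` to `z · h` with constant velocity `h` in the left-invariant
frame. -/
lemma exists_isAdmissibleCurve (Φ : HermitianMap E F) (z h : E × F) {ε : ℝ}
    (hε : homNorm h ≤ ε) :
    ∃ γ : ℝ → E × F, γ 0 = z ∧ γ 1 = nMul Φ z h ∧ IsAdmissibleCurve Φ ε γ := by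
  refine ⟨fun s => z + s • (h.1, h.2 + (2 : ℝ) • Φ.im z.1 h.1), ?_, ?_, ?_, ?_⟩
  · simp
  · ext
    · simp [nMul]
    · simp [nMul, add_assoc]
  · refine ContDiffOn.absolutelyContinuousOnInterval (ContDiff.contDiffOn ?_)
    fun_prop
  · refine ae_of_all _ fun s => ⟨h.1, h.2, ?_, (le_max_left _ _).trans hε,
      (le_max_right _ _).trans hε⟩
    have : HasDerivAt (fun s : ℝ => z + s • (h.1, h.2 + (2 : ℝ) • Φ.im z.1 h.1))
        ((1 : ℝ) • (h.1, h.2 + (2 : ℝ) • Φ.im z.1 h.1)) s :=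
      ((hasDerivAt_id s).smul_const _).const_add z
    simpa [Φ.im_add_left, Φ.im_smul_left, Φ.im_self] using this

lemma ctrlDist_nMul_le_homNorm (Φ : HermitianMap E F) (z h : E × F) :
    ctrlDist Φ z (nMul Φ z h) ≤ homNorm h := by
  refine le_of_forall_pos_le_add fun η hη => ?_
  exact csInf_le ⟨0, fun ε hε => hε.1.le⟩ ⟨by linarith [homNorm_nonneg h],
    exists_isAdmissibleCurve Φ z h (by linarith)⟩

end Comparison

section Group

variable {E F : Type*} [NormedAddCommGroup E] [InnerProductSpace ℂ E] [FiniteDimensional ℂ E]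
  [NormedAddCommGroup F] [InnerProductSpace ℝ F]

lemma continuous_nMul (Φ : HermitianMap E F) :
    Continuous fun q : (E × F) × (E × F) => nMul Φ q.1 q.2 := by
  have h : Continuous fun q : (E × F) × (E × F) => Φ.imCLM q.1.1 q.2.1 := by fun_prop
  exact (by fun_prop : Continuous fun q : (E × F) × (E × F) => q.1.1 + q.2.1).prodMk
    ((by fun_prop : Continuous fun q : (E × F) × (E × F) => q.1.2 + q.2.2).add
      (h.const_smul (2 : ℝ)))

lemma isOpen_homBall (Φ : HermitianMap E F) (z : E × F) (r : ℝ) : IsOpen (homBall Φ z r) :=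
  isOpen_lt (continuous_homNorm.comp ((continuous_nMul Φ).comp
    (by fun_prop : Continuous fun y : E × F => (nInv z, y)))) continuous_const

/-- The constant `1 + 2 ‖Im Φ‖`, which serves both in the lower bound of the control distance by
the homogeneous norm and in the submultiplicativity of `1 + ‖v‖`. -/
noncomputable def ctrlConst (Φ : HermitianMap E F) : ℝ := 1 + 2 * ‖Φ.imCLM‖

lemma one_le_ctrlConst (Φ : HermitianMap E F) : 1 ≤ ctrlConst Φ := by
  have := norm_nonneg Φ.imCLM
  unfold ctrlConst; linarith

/-- The component in `E` of an admissible curve is `ε`-Lipschitz. The component in `F` of its left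
translate `γ(0)⁻¹ γ` then has velocity `b + 2 Im Φ(γ_E - γ_E(0), a)`, which is `O(ε ^ 2)`. -/
lemma homNorm_le_of_isAdmissibleCurve (Φ : HermitianMap E F) {ε : ℝ} (hε : 0 < ε)
    {γ : ℝ → E × F} (hγ : IsAdmissibleCurve Φ ε γ) :
    homNorm (nMul Φ (nInv (γ 0)) (γ 1)) ≤ ctrlConst Φ * ε := by
  obtain ⟨hac, hd⟩ := hγ
  set z := γ 0 with hz
  have hE : ∀ t ∈ Set.Icc (0 : ℝ) 1, ‖(γ t).1 - z.1‖ ≤ ε := by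
    intro t ht
    refine AbsolutelyContinuousOnInterval.norm_sub_le (f := fun s => (γ s).1) hε.le
      (hac.lipschitz_comp LipschitzWith.prod_fst) ?_ ht
    filter_upwards [hd] with s hs
    obtain ⟨a, b, hab, ha, -⟩ := hs
    exact ⟨a, hab.fst, ha⟩
  let L : E × F →L[ℝ] F := ContinuousLinearMap.snd ℝ E F -
    (2 : ℝ) • (Φ.imCLM z.1).comp (ContinuousLinearMap.fst ℝ E F)
  have hL : ∀ w : E × F, L w = w.2 - (2 : ℝ) • Φ.im z.1 w.1 := fun w => rfl
  have hF : ‖L (γ 1) - L (γ 0)‖ ≤ ctrlConst Φ * ε ^ 2 := by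
    refine AbsolutelyContinuousOnInterval.norm_sub_le (f := fun s => L (γ s))
      (by have := one_le_ctrlConst Φ; positivity)
      (hac.lipschitz_comp L.lipschitz) ?_ ⟨zero_le_one, le_rfl⟩
    filter_upwards [hd, ae_restrict_mem measurableSet_Icc] with s hs hs01
    obtain ⟨a, b, hab, ha, hb⟩ := hs
    refine ⟨_, L.hasFDerivAt.comp_hasDerivAt s hab, ?_⟩
    have h1 : L (a, b + (2 : ℝ) • Φ.im (γ s).1 a) = b + (2 : ℝ) • Φ.im ((γ s).1 - z.1) a := by
      rw [hL, Φ.im_sub_left, smul_sub]; simp only; abel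
    rw [h1]
    have h2 := Φ.norm_im_le ((γ s).1 - z.1) a
    have h3 : ‖b‖ ≤ ε ^ 2 := (Real.sqrt_le_left hε.le).1 hb
    have h4 : ‖Φ.imCLM‖ * ‖(γ s).1 - z.1‖ * ‖a‖ ≤ ‖Φ.imCLM‖ * ε * ε := by
      gcongr
      exact hE s hs01
    calc ‖b + (2 : ℝ) • Φ.im ((γ s).1 - z.1) a‖
        ≤ ‖b‖ + ‖(2 : ℝ) • Φ.im ((γ s).1 - z.1) a‖ := norm_add_le _ _
      _ = ‖b‖ + 2 * ‖Φ.im ((γ s).1 - z.1) a‖ := by rw [norm_smul]; norm_num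
      _ ≤ ctrlConst Φ * ε ^ 2 := by unfold ctrlConst; linarith
  have hC := one_le_ctrlConst Φ
  refine max_le ?_ ?_
  · have h := hE 1 ⟨zero_le_one, le_rfl⟩
    have : (nMul Φ (nInv z) (γ 1)).1 = (γ 1).1 - z.1 := by simp [nMul, nInv]; abel
    rw [this]
    nlinarith
  · have : (nMul Φ (nInv z) (γ 1)).2 = L (γ 1) - L (γ 0) := by
      rw [hL, hL, ← hz]; simp [nMul, nInv, Φ.im_neg_left, Φ.im_self]; abel
    rw [this]
    refine Real.sqrt_le_iff.2 ⟨by positivity, hF.trans ?_⟩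
    nlinarith [sq_nonneg ε, mul_nonneg (mul_nonneg (by linarith : 0 ≤ ctrlConst Φ) (sq_nonneg ε))
      (by linarith : 0 ≤ ctrlConst Φ - 1)]

lemma homNorm_le_ctrlDist (Φ : HermitianMap E F) (z w : E × F) :
    homNorm (nMul Φ (nInv z) w) ≤ ctrlConst Φ * ctrlDist Φ z w := by
  have hC := one_le_ctrlConst Φ
  rw [← div_le_iff₀' (by linarith)]
  refine le_csInf ?_ ?_
  · have h0 := homNorm_nonneg (nMul Φ (nInv z) w)
    have h1 := exists_isAdmissibleCurve Φ z (nMul Φ (nInv z) w)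
      (ε := homNorm (nMul Φ (nInv z) w) + 1) (by linarith)
    rw [nMul_nInv_nMul] at h1
    exact ⟨_, by linarith, h1⟩
  · rintro ε ⟨hε, γ, rfl, rfl, hγ⟩
    rw [div_le_iff₀' (by linarith)]
    exact homNorm_le_of_isAdmissibleCurve Φ hε hγ

lemma norm_nMul_le (Φ : HermitianMap E F) (v w : E × F) :
    ‖nMul Φ v w‖ ≤ ‖v‖ + ‖w‖ + 2 * ‖Φ.imCLM‖ * ‖v‖ * ‖w‖ := by
  have h1 : ‖v.1‖ ≤ ‖v‖ := norm_fst_le v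
  have h2 : ‖w.1‖ ≤ ‖w‖ := norm_fst_le w
  have h3 : ‖v.2‖ ≤ ‖v‖ := norm_snd_le v
  have h4 : ‖w.2‖ ≤ ‖w‖ := norm_snd_le w
  have h5 := Φ.norm_im_le v.1 w.1
  have h6 : ‖Φ.imCLM‖ * ‖v.1‖ * ‖w.1‖ ≤ ‖Φ.imCLM‖ * ‖v‖ * ‖w‖ := by gcongr
  have h7 : 0 ≤ ‖Φ.imCLM‖ * ‖v‖ * ‖w‖ := by positivity
  rw [Prod.norm_def]
  refine max_le ?_ ?_
  · calc ‖v.1 + w.1‖ ≤ ‖v.1‖ + ‖w.1‖ := norm_add_le _ _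
      _ ≤ _ := by linarith
  · calc ‖v.2 + w.2 + (2 : ℝ) • Φ.im v.1 w.1‖
        ≤ ‖v.2‖ + ‖w.2‖ + ‖(2 : ℝ) • Φ.im v.1 w.1‖ := norm_add₃_le
      _ = ‖v.2‖ + ‖w.2‖ + 2 * ‖Φ.im v.1 w.1‖ := by rw [norm_smul]; norm_num
      _ ≤ _ := by linarith

lemma one_add_norm_nMul_le (Φ : HermitianMap E F) (v w : E × F) :
    1 + ‖nMul Φ v w‖ ≤ ctrlConst Φ * (1 + ‖v‖) * (1 + ‖w‖) := by
  have h := norm_nMul_le Φ v w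
  have h0 := norm_nonneg Φ.imCLM
  have h1 := norm_nonneg v
  have h2 := norm_nonneg w
  unfold ctrlConst
  nlinarith [mul_nonneg h0 h1, mul_nonneg h0 h2, mul_nonneg h1 h2]

end Group

/-! ### Haar measure on the group -/

section Haar

variable {E F : Type*} [NormedAddCommGroup E] [InnerProductSpace ℂ E] [FiniteDimensional ℂ E]
  [MeasurableSpace E] [BorelSpace E]
  [NormedAddCommGroup F] [InnerProductSpace ℝ F] [FiniteDimensional ℝ F]
  [MeasurableSpace F] [BorelSpace F]

/-- Shears of `E × F` along `F` preserve Lebesgue measure. -/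
lemma measurePreserving_shear (μ : Measure (E × F)) [μ.IsAddHaarMeasure] (L : E →ₗ[ℝ] F) :
    MeasurePreserving (fun z : E × F => (z.1, z.2 + L z.1)) μ μ := by
  let S : E × F →ₗ[ℝ] E × F := (LinearMap.fst ℝ E F).prod
    (LinearMap.snd ℝ E F + L ∘ₗ LinearMap.fst ℝ E F)
  let D : E × F →ₗ[ℝ] E × F := (LinearMap.fst ℝ E F).prod (-LinearMap.snd ℝ E F)
  have hDD : D * D = 1 := by ext <;> simp [D]
  -- Conjugating `S` by the reflection `D` of `F` gives its inverse, so that `det S ^ 2 = 1`.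
  have hSDS : S * D * S = D := by ext <;> simp [S, D]
  have hD : LinearMap.det D * LinearMap.det D = 1 := by rw [← map_mul, hDD, map_one]
  have hS : LinearMap.det S * LinearMap.det S = 1 := by
    have h := congrArg LinearMap.det hSDS
    rw [map_mul, map_mul] at h
    linear_combination LinearMap.det D * h + (1 - LinearMap.det S * LinearMap.det S) * hD
  have habs : |(LinearMap.det S)⁻¹| = 1 := by
    rw [abs_inv, ← abs_one (α := ℝ), (abs_eq_abs.2 (mul_self_eq_one_iff.1 hS)), abs_one, inv_one]
  have hc : Continuous S := S.continuous_of_finiteDimensional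
  refine ⟨hc.measurable, ?_⟩
  have h := Measure.map_linearMap_addHaar_eq_smul_addHaar μ (f := S)
    (by intro h0; rw [h0] at hS; simp at hS)
  rw [habs] at h
  rw [ENNReal.ofReal_one, one_smul] at h
  exact h

/-- Left translations of the group preserve Lebesgue measure. -/
lemma measurePreserving_nMul_left (Φ : HermitianMap E F) (μ : Measure (E × F))
    [μ.IsAddHaarMeasure] (w : E × F) : MeasurePreserving (fun z => nMul Φ w z) μ μ := by
  have h := (measurePreserving_add_left μ w).comp
    (measurePreserving_shear μ ((2 : ℝ) • (Φ.imCLM w.1 : E →ₗ[ℝ] F)))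
  convert! h using 2 with z
  ext
  · simp [nMul]
  · simp [nMul, HermitianMap.imCLM_apply, add_assoc]

lemma lintegral_nMul_left (Φ : HermitianMap E F) (μ : Measure (E × F))
    [μ.IsAddHaarMeasure] (w : E × F) {f : E × F → ℝ≥0∞} (hf : Measurable f) :
    ∫⁻ z, f (nMul Φ w z) ∂μ = ∫⁻ z, f z ∂μ :=
  (measurePreserving_nMul_left Φ μ w).lintegral_comp hf

/-- Invariance under inversion and right translations. -/
lemma lintegral_nInv_nMul (Φ : HermitianMap E F) (μ : Measure (E × F))
    [μ.IsAddHaarMeasure] (z : E × F) {f : E × F → ℝ≥0∞} (hf : Measurable f) :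
    ∫⁻ y, f (nMul Φ (nInv y) z) ∂μ = ∫⁻ y, f y ∂μ := by
  have h : ∀ y, nMul Φ (nInv y) z = -(nMul Φ (nInv z) y) := fun y => by
    rw [← nInv_eq_neg, nInv_nMul, nInv_eq_neg (nInv z), nInv_eq_neg z, neg_neg]
  simp_rw [h]
  rw [lintegral_nMul_left Φ μ (nInv z) (f := fun y => f (-y)) (by fun_prop)]
  exact (Measure.measurePreserving_neg μ).lintegral_comp hf

/-- The dilation `(ζ, x) ↦ (r ζ, r² x)` has determinant `r ^ (2 n + 2 m)`, as `dim_ℝ E = 2 n`. -/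
lemma measure_homNorm_lt (μ : Measure (E × F)) [μ.IsAddHaarMeasure] {r : ℝ} (hr : 0 < r) :
    μ {h | homNorm h < r} = ENNReal.ofReal
      (r ^ (2 * ((Module.finrank ℂ E + Module.finrank ℝ F : ℕ) : ℝ))) *
        μ {h | homNorm h < 1} := by
  let D : E × F →ₗ[ℝ] E × F := (r • LinearMap.id).prodMap (r ^ 2 • LinearMap.id)
  have hdet : LinearMap.det D = r ^ (2 * (Module.finrank ℂ E + Module.finrank ℝ F)) := by
    rw [LinearMap.det_prodMap, LinearMap.det_smul, LinearMap.det_smul, LinearMap.det_id,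
      LinearMap.det_id, finrank_real_of_complex]
    ring
  have hpos : 0 < r ^ (2 * (Module.finrank ℂ E + Module.finrank ℝ F)) := by positivity
  have h := Measure.addHaar_preimage_linearMap μ (f := D) (by rw [hdet]; exact hpos.ne')
    {h | homNorm h < r}
  have hpre : D ⁻¹' {h | homNorm h < r} = {h | homNorm h < 1} := by
    ext ⟨a, b⟩
    have h1 : homNorm (D (a, b)) = r * homNorm (a, b) := by
      have : Real.sqrt ‖r ^ 2 • b‖ = r * Real.sqrt ‖b‖ := by
        rw [norm_smul, Real.sqrt_mul (norm_nonneg _), Real.norm_of_nonneg (sq_nonneg r),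
          Real.sqrt_sq hr.le]
      have h2 : homNorm (D (a, b)) = max ‖r • a‖ (Real.sqrt ‖r ^ 2 • b‖) := rfl
      rw [h2, this, norm_smul, Real.norm_of_nonneg hr.le, homNorm, mul_max_of_nonneg _ _ hr.le]
    change homNorm (D (a, b)) < r ↔ homNorm (a, b) < 1
    rw [h1]
    constructor <;> intro h2 <;> nlinarith
  rw [hpre, hdet, abs_of_pos (by positivity)] at h
  have hcast : r ^ (2 * ((Module.finrank ℂ E + Module.finrank ℝ F : ℕ) : ℝ)) =
      r ^ (2 * (Module.finrank ℂ E + Module.finrank ℝ F)) := by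
    rw [← Real.rpow_natCast]; push_cast; rfl
  rw [h, hcast, ← mul_assoc, ← ENNReal.ofReal_mul hpos.le, mul_inv_cancel₀ hpos.ne',
    ENNReal.ofReal_one, one_mul]

lemma measure_homBall (Φ : HermitianMap E F) (μ : Measure (E × F)) [μ.IsAddHaarMeasure]
    (z : E × F) {r : ℝ} (hr : 0 < r) :
    μ (homBall Φ z r) = ENNReal.ofReal
      (r ^ (2 * ((Module.finrank ℂ E + Module.finrank ℝ F : ℕ) : ℝ))) *
        μ {h | homNorm h < 1} := by
  rw [← measure_homNorm_lt μ hr]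
  exact (measurePreserving_nMul_left Φ μ (nInv z)).measure_preimage
    (isOpen_lt continuous_homNorm continuous_const).measurableSet.nullMeasurableSet

lemma measure_homNorm_lt_one_ne_zero (μ : Measure (E × F)) [μ.IsAddHaarMeasure] :
    μ {h : E × F | homNorm h < 1} ≠ 0 :=
  ((isOpen_lt continuous_homNorm continuous_const).measure_pos μ ⟨0, by simp [homNorm]⟩).ne'

lemma measure_homNorm_lt_one_ne_top (μ : Measure (E × F)) [μ.IsAddHaarMeasure] :
    μ {h : E × F | homNorm h < 1} ≠ ∞ := by
  have hsub : {h : E × F | homNorm h < 1} ⊆ Metric.ball 0 1 := by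
    intro h hh
    have h1 : ‖h.1‖ < 1 := (le_max_left _ _).trans_lt hh
    have h2 : Real.sqrt ‖h.2‖ < 1 := (le_max_right _ _).trans_lt hh
    rw [Real.sqrt_lt' one_pos] at h2
    rw [mem_ball_zero_iff, Prod.norm_def]
    exact max_lt h1 (by simpa using h2)
  exact ((measure_mono hsub).trans_lt measure_ball_lt_top).ne

end Haar

/-! ### Averages against polynomially decaying weights -/

section Average

variable {E F : Type*} [NormedAddCommGroup E] [InnerProductSpace ℂ E] [FiniteDimensional ℂ E]
  [MeasurableSpace E] [BorelSpace E]
  [NormedAddCommGroup F] [InnerProductSpace ℝ F] [FiniteDimensional ℝ F]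
  [MeasurableSpace F] [BorelSpace F]

/-- The weight `1 + ‖v‖`, as an element of `[0, ∞]`. It is submultiplicative on the group up to a
constant, which makes it as convenient as a homogeneous weight. -/
noncomputable def wt (v : E × F) : ℝ≥0∞ := ENNReal.ofReal (1 + ‖v‖)

lemma one_le_wt (v : E × F) : 1 ≤ wt v := by
  rw [wt, ENNReal.one_le_ofReal]
  linarith [norm_nonneg v]

lemma wt_ne_zero (v : E × F) : wt v ≠ 0 := (zero_lt_one.trans_le (one_le_wt v)).ne'

lemma wt_ne_top (v : E × F) : wt v ≠ ∞ := ENNReal.ofReal_ne_top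

lemma wt_nInv (v : E × F) : wt (nInv v) = wt v := by rw [nInv_eq_neg, wt, wt, norm_neg]

lemma measurable_wt : Measurable (wt : E × F → ℝ≥0∞) := by unfold wt; fun_prop

lemma wt_nMul_le (Φ : HermitianMap E F) (v w : E × F) :
    wt (nMul Φ v w) ≤ ENNReal.ofReal (ctrlConst Φ) * wt v * wt w := by
  have hC := one_le_ctrlConst Φ
  rw [wt, wt, wt, ← ENNReal.ofReal_mul (by positivity),
    ← ENNReal.ofReal_mul (by positivity)]
  exact ENNReal.ofReal_le_ofReal (one_add_norm_nMul_le Φ v w)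

lemma lintegral_wt_rpow_lt_top (μ : Measure (E × F)) [μ.IsAddHaarMeasure] {r : ℝ}
    (hr : (Module.finrank ℝ (E × F) : ℝ) < r) : ∫⁻ v, wt v ^ (-r) ∂μ < ∞ := by
  refine lt_of_le_of_lt (le_of_eq (lintegral_congr fun v => ?_))
    (finite_integral_one_add_norm (μ := μ) hr)
  rw [wt, ENNReal.ofReal_rpow_of_pos (by positivity)]

lemma lintegral_wt_rpow_ne_zero (μ : Measure (E × F)) [μ.IsAddHaarMeasure] (r : ℝ) :
    ∫⁻ v, wt v ^ (-r) ∂μ ≠ 0 := by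
  rw [Ne, lintegral_eq_zero_iff (measurable_wt.pow_const _)]
  intro h
  have h1 : ∀ᵐ v ∂μ, False := by
    filter_upwards [h] with v hv
    simp [ENNReal.rpow_eq_zero_iff, wt_ne_zero, wt_ne_top] at hv
  have h2 : μ Set.univ = 0 := by simpa [ae_iff] using h1
  exact NeZero.ne μ (Measure.measure_univ_eq_zero.1 h2)

/-- The average `∫ U(y) (1 + ‖y⁻¹ z‖)^{-M} dy`. -/
noncomputable def avg (Φ : HermitianMap E F) (μ : Measure (E × F)) (M : ℝ) (U : E × F → ℝ≥0∞)
    (z : E × F) : ℝ≥0∞ :=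
  ∫⁻ y, U y * wt (nMul Φ (nInv y) z) ^ (-M) ∂μ

lemma measurable_wt_nInv_nMul (Φ : HermitianMap E F) :
    Measurable fun q : (E × F) × (E × F) => wt (nMul Φ (nInv q.2) q.1) :=
  measurable_wt.comp ((continuous_nMul Φ).comp
    (continuous_snd.neg.prodMk continuous_fst)).measurable

lemma measurable_wt_nInv_nMul_right (Φ : HermitianMap E F) (y : E × F) :
    Measurable fun z : E × F => wt (nMul Φ (nInv y) z) :=
  measurable_wt.comp ((continuous_nMul Φ).comp
    (continuous_const.prodMk continuous_id : Continuous fun z : E × F => (nInv y, z))).measurable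

lemma measurable_wt_nInv_nMul_left (Φ : HermitianMap E F) (z : E × F) :
    Measurable fun y : E × F => wt (nMul Φ (nInv y) z) :=
  measurable_wt.comp ((continuous_nMul Φ).comp
    (continuous_neg.prodMk continuous_const : Continuous fun y : E × F => (nInv y, z))).measurable

variable (Φ : HermitianMap E F) (μ : Measure (E × F)) [μ.IsAddHaarMeasure]

lemma measurable_avg (M : ℝ) {U : E × F → ℝ≥0∞} (hU : Measurable U) :
    Measurable (avg Φ μ M U) :=
  Measurable.lintegral_prod_right' (f := fun q : (E × F) × (E × F) =>
    U q.2 * wt (nMul Φ (nInv q.2) q.1) ^ (-M))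
    ((hU.comp measurable_snd).mul ((measurable_wt_nInv_nMul Φ).pow_const _))

lemma lintegral_avg (M : ℝ) {U : E × F → ℝ≥0∞} (hU : Measurable U) :
    ∫⁻ z, avg Φ μ M U z ∂μ = (∫⁻ y, U y ∂μ) * ∫⁻ v, wt v ^ (-M) ∂μ := by
  unfold avg
  rw [lintegral_lintegral_swap]
  · rw [← lintegral_mul_const _ hU]
    refine lintegral_congr fun y => ?_
    rw [lintegral_const_mul _ ((measurable_wt_nInv_nMul_right Φ y).pow_const _),
      lintegral_nMul_left Φ μ (nInv y) (f := fun v => wt v ^ (-M)) (measurable_wt.pow_const _)]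
  · exact (((hU.comp measurable_snd).mul
      ((measurable_wt_nInv_nMul Φ).pow_const _))).aemeasurable

lemma lintegral_wt_nInv_nMul (M : ℝ) (z : E × F) :
    ∫⁻ y, wt (nMul Φ (nInv y) z) ^ (-M) ∂μ = ∫⁻ v, wt v ^ (-M) ∂μ :=
  lintegral_nInv_nMul Φ μ z (f := fun v => wt v ^ (-M)) (measurable_wt.pow_const _)

/-- The averages at two points differ by a factor which grows polynomially with their distance. -/
lemma avg_le_mul_avg {M : ℝ} (hM : 0 ≤ M) (U : E × F → ℝ≥0∞) (w z : E × F) :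
    avg Φ μ M U w ≤
      (ENNReal.ofReal (ctrlConst Φ) * wt (nMul Φ (nInv w) z)) ^ M * avg Φ μ M U z := by
  have hC := one_le_ctrlConst Φ
  unfold avg
  rw [← lintegral_const_mul' _ _ (ENNReal.rpow_ne_top_of_nonneg hM
    (ENNReal.mul_ne_top ENNReal.ofReal_ne_top (wt_ne_top _)))]
  refine lintegral_mono fun y => ?_
  have h1 : nMul Φ (nInv y) z = nMul Φ (nMul Φ (nInv y) w) (nMul Φ (nInv w) z) := by
    rw [nMul_assoc, nMul_nInv_nMul]
  have h2 := wt_nMul_le Φ (nMul Φ (nInv y) w) (nMul Φ (nInv w) z)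
  rw [← h1] at h2
  set a := wt (nMul Φ (nInv y) w)
  set b := wt (nMul Φ (nInv y) z)
  set c := wt (nMul Φ (nInv w) z)
  have ha0 : a ≠ 0 := wt_ne_zero _
  have ha1 : a ≠ ∞ := wt_ne_top _
  have h3 : b ^ M ≤ (ENNReal.ofReal (ctrlConst Φ) * c) ^ M * a ^ M := by
    rw [← ENNReal.mul_rpow_of_nonneg _ _ hM]
    exact ENNReal.rpow_le_rpow (h2.trans (le_of_eq (by ring))) hM
  have h4 : a ^ (-M) ≤ (ENNReal.ofReal (ctrlConst Φ) * c) ^ M * b ^ (-M) := by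
    rw [ENNReal.rpow_neg, ENNReal.rpow_neg, ← div_eq_mul_inv,
      ENNReal.le_div_iff_mul_le (Or.inl (by simp [ENNReal.rpow_eq_zero_iff, wt_ne_zero, wt_ne_top]))
        (Or.inl (ENNReal.rpow_ne_top_of_nonneg hM (wt_ne_top _))), mul_comm,
      ← div_eq_mul_inv, ENNReal.div_le_iff (by simp [ENNReal.rpow_eq_zero_iff, ha0, ha1])
        (ENNReal.rpow_ne_top_of_nonneg hM ha1)]
    exact h3
  calc U y * a ^ (-M) ≤ U y * ((ENNReal.ofReal (ctrlConst Φ) * c) ^ M * b ^ (-M)) := by gcongr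
    _ = _ := by ring

/-- Young's inequality for the averages. -/
lemma eLpNorm_avg_le_of_one_le {M : ℝ} (hM : (Module.finrank ℝ (E × F) : ℝ) < M)
    {U : E × F → ℝ≥0∞} (hU : Measurable U) {p : ℝ≥0∞} (hp : 1 ≤ p) :
    eLpNorm (avg Φ μ M U) p μ ≤ (∫⁻ v, wt v ^ (-M) ∂μ) * eLpNorm U p μ := by
  set κ := ∫⁻ v, wt v ^ (-M) ∂μ with hκ
  have hκ0 : κ ≠ 0 := lintegral_wt_rpow_ne_zero μ M
  have hκ1 : κ ≠ ∞ := (lintegral_wt_rpow_lt_top μ hM).ne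
  -- `avg` is an `L¹` norm for a measure of mass `κ`, to be compared with the `L^p` norm.
  let ν : E × F → Measure (E × F) := fun z =>
    μ.withDensity fun y => wt (nMul Φ (nInv y) z) ^ (-M)
  have hk : ∀ z, Measurable fun y => wt (nMul Φ (nInv y) z) ^ (-M) := fun z =>
    (measurable_wt_nInv_nMul_left Φ z).pow_const _
  have hν : ∀ z, ν z Set.univ = κ := fun z => by
    rw [withDensity_apply _ MeasurableSet.univ, Measure.restrict_univ,
      lintegral_wt_nInv_nMul Φ μ M z]
  have havg : ∀ z, avg Φ μ M U z = eLpNorm U 1 (ν z) := fun z => by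
    rw [eLpNorm_one_eq_lintegral_enorm,
      lintegral_withDensity_eq_lintegral_mul _ (hk z) (by simpa using hU)]
    refine lintegral_congr fun y => ?_
    simp [mul_comm]
  have hle : ∀ z, avg Φ μ M U z ≤ eLpNorm U p (ν z) * κ ^ (1 - 1 / p.toReal) := fun z => by
    have h := eLpNorm_le_eLpNorm_mul_rpow_measure_univ (μ := ν z) hp
      (f := U) hU.aestronglyMeasurable
    rw [hν] at h
    rw [havg]
    simpa using h
  rcases eq_or_ne p ∞ with rfl | hp'
  · refine eLpNormEssSup_le_of_ae_enorm_bound (ae_of_all _ fun z => ?_)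
    refine (hle z).trans ?_
    simp only [ENNReal.toReal_top, div_zero, sub_zero, ENNReal.rpow_one]
    rw [mul_comm]
    exact mul_le_mul_right (eLpNormEssSup_mono_measure U (withDensity_absolutelyContinuous μ _)) κ
  · have hp0 : p ≠ 0 := (zero_lt_one.trans_le hp).ne'
    have hpr : 1 ≤ p.toReal := by
      rw [← ENNReal.toReal_one]; exact (ENNReal.toReal_le_toReal ENNReal.one_ne_top hp').2 hp
    have hpr0 : 0 < p.toReal := by linarith
    rw [eLpNorm_eq_lintegral_rpow_enorm_toReal hp0 hp',
      eLpNorm_eq_lintegral_rpow_enorm_toReal hp0 hp', one_div, ENNReal.rpow_inv_le_iff hpr0,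
      ENNReal.mul_rpow_of_nonneg _ _ hpr0.le, ENNReal.rpow_inv_rpow hpr0.ne']
    simp only [enorm_eq_self]
    have hpt : ∀ z, avg Φ μ M U z ^ p.toReal ≤
        κ ^ (p.toReal - 1) * avg Φ μ M (fun y => U y ^ p.toReal) z := fun z => by
      refine (ENNReal.rpow_le_rpow (hle z) hpr0.le).trans (le_of_eq ?_)
      rw [ENNReal.mul_rpow_of_nonneg _ _ hpr0.le, ← ENNReal.rpow_mul,
        eLpNorm_eq_lintegral_rpow_enorm_toReal hp0 hp', one_div, ENNReal.rpow_inv_rpow hpr0.ne',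
        mul_comm]
      congr 1
      · congr 1; field_simp
      · rw [lintegral_withDensity_eq_lintegral_mul _ (hk z) (by simpa using hU.pow_const _)]
        refine lintegral_congr fun y => ?_
        simp [mul_comm]
    calc ∫⁻ z, avg Φ μ M U z ^ p.toReal ∂μ
        ≤ ∫⁻ z, κ ^ (p.toReal - 1) * avg Φ μ M (fun y => U y ^ p.toReal) z ∂μ :=
          lintegral_mono hpt
      _ = κ ^ (p.toReal - 1) * ((∫⁻ y, U y ^ p.toReal ∂μ) * κ) := by
          rw [lintegral_const_mul _ (measurable_avg Φ μ M (hU.pow_const _)),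
            lintegral_avg Φ μ M (hU.pow_const _)]
      _ = κ ^ (p.toReal - 1) * κ ^ (1 : ℝ) * ∫⁻ y, U y ^ p.toReal ∂μ := by
          rw [ENNReal.rpow_one]; ring
      _ = κ ^ p.toReal * ∫⁻ y, U y ^ p.toReal ∂μ := by
          rw [← ENNReal.rpow_add _ _ hκ0 hκ1, sub_add_cancel]

/-- For `p ≤ 1`, a self-improvement of the bound of `U` by its averages: in `U = U^p U^{1-p}` the
last factor is bounded by the average at `z`, which is then divided out, being finite. -/
lemma avg_rpow_le {M p : ℝ} {C : ℝ≥0∞} (hM : 0 ≤ M) (hp0 : 0 < p) (hp1 : p ≤ 1)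
    (hC : C ≠ ∞) {U : E × F → ℝ≥0∞} (hU : ∀ w, U w ≤ C * avg Φ μ M U w)
    (z : E × F) (hz : avg Φ μ M U z ≠ ∞) :
    avg Φ μ M U z ^ p ≤ (C * ENNReal.ofReal (ctrlConst Φ) ^ M) ^ (1 - p) *
      avg Φ μ (M * p) (fun y => U y ^ p) z := by
  set h := avg Φ μ M U z with hh
  set A := ENNReal.ofReal (ctrlConst Φ)
  have hp1' : 0 ≤ 1 - p := by linarith
  have hAM : A ^ M ≠ ∞ := ENNReal.rpow_ne_top_of_nonneg hM ENNReal.ofReal_ne_top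
  have hfin : ((C * A ^ M) * h) ^ (1 - p) ≠ ∞ := ENNReal.rpow_ne_top_of_nonneg hp1'
    (ENNReal.mul_ne_top (ENNReal.mul_ne_top hC hAM) hz)
  have hpt : ∀ y, U y * wt (nMul Φ (nInv y) z) ^ (-M) ≤
      ((C * A ^ M) * h) ^ (1 - p) * (U y ^ p * wt (nMul Φ (nInv y) z) ^ (-(M * p))) := by
    intro y
    set w := wt (nMul Φ (nInv y) z)
    have hw0 : w ≠ 0 := wt_ne_zero _
    have hw1 : w ≠ ∞ := wt_ne_top _
    have h1 : U y ≤ (C * A ^ M) * h * w ^ M := by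
      refine (hU y).trans ((mul_le_mul_right (avg_le_mul_avg Φ μ hM U y z) C).trans (le_of_eq ?_))
      rw [ENNReal.mul_rpow_of_nonneg _ _ hM]; ring
    calc U y * w ^ (-M) = U y ^ p * U y ^ (1 - p) * w ^ (-M) := by
          rw [← ENNReal.rpow_add_of_nonneg _ _ hp0.le hp1', add_sub_cancel, ENNReal.rpow_one]
      _ ≤ U y ^ p * ((C * A ^ M) * h * w ^ M) ^ (1 - p) * w ^ (-M) := by gcongr
      _ = ((C * A ^ M) * h) ^ (1 - p) * (U y ^ p * (w ^ (M * (1 - p)) * w ^ (-M))) := by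
          rw [ENNReal.mul_rpow_of_nonneg _ (w ^ M) hp1', ← ENNReal.rpow_mul]; ring
      _ = _ := by
          rw [← ENNReal.rpow_add _ _ hw0 hw1]
          congr 4; ring
  have hle : h ≤ ((C * A ^ M) * h) ^ (1 - p) * avg Φ μ (M * p) (fun y => U y ^ p) z := by
    conv_rhs => rw [avg, ← lintegral_const_mul' _ _ hfin]
    exact lintegral_mono hpt
  rcases eq_or_ne h 0 with h0 | h0
  · rw [h0, ENNReal.zero_rpow_of_pos hp0]; exact zero_le
  · have hq0 : h ^ (1 - p) ≠ 0 := by simp [ENNReal.rpow_eq_zero_iff, h0, hz]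
    have hq1 : h ^ (1 - p) ≠ ∞ := ENNReal.rpow_ne_top_of_nonneg hp1' hz
    rw [← ENNReal.mul_le_mul_iff_left hq0 hq1, ← ENNReal.rpow_add_of_nonneg _ _ hp0.le hp1',
      add_sub_cancel, ENNReal.rpow_one]
    refine hle.trans (le_of_eq ?_)
    rw [ENNReal.mul_rpow_of_nonneg _ _ hp1']; ring

/-- If `U` has polynomial growth, then its averages with weights of fast enough decay are finite. -/
lemma avg_ne_top_of_le_wt {M m : ℝ} {B : ℝ≥0∞} (hm : 0 ≤ m) (hB : B ≠ ∞)
    (hM : (Module.finrank ℝ (E × F) : ℝ) < M - m) {U : E × F → ℝ≥0∞}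
    (hU : ∀ w, U w ≤ B * wt w ^ m) (z : E × F) : avg Φ μ M U z ≠ ∞ := by
  set A := ENNReal.ofReal (ctrlConst Φ)
  have hpt : ∀ y, U y * wt (nMul Φ (nInv y) z) ^ (-M) ≤
      B * (A * wt z) ^ m * wt (nMul Φ (nInv y) z) ^ (-(M - m)) := by
    intro y
    have h1 : nMul Φ z (nInv (nMul Φ (nInv y) z)) = y := by
      rw [nInv_nMul, nMul_nInv_nMul]; simp [nInv]
    have h2 := wt_nMul_le Φ z (nInv (nMul Φ (nInv y) z))
    rw [h1, wt_nInv] at h2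
    set w := wt (nMul Φ (nInv y) z)
    calc U y * w ^ (-M) ≤ B * (A * wt z * w) ^ m * w ^ (-M) := by
          gcongr
          exact (hU y).trans (by gcongr)
      _ = B * (A * wt z) ^ m * (w ^ m * w ^ (-M)) := by
          rw [ENNReal.mul_rpow_of_nonneg _ w hm]; ring
      _ = _ := by
          rw [← ENNReal.rpow_add _ _ (wt_ne_zero _) (wt_ne_top _)]
          congr 2; ring
  have hfin : B * (A * wt z) ^ m ≠ ∞ := ENNReal.mul_ne_top hB
    (ENNReal.rpow_ne_top_of_nonneg hm (ENNReal.mul_ne_top ENNReal.ofReal_ne_top (wt_ne_top _)))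
  refine ((lintegral_mono hpt).trans_lt ?_).ne
  rw [lintegral_const_mul' _ _ hfin, lintegral_wt_nInv_nMul]
  exact ENNReal.mul_lt_top hfin.lt_top (lintegral_wt_rpow_lt_top μ hM)

/-- For `p ≤ 1`, a function `U` of polynomial growth which is dominated by its averages for weights
of arbitrarily fast decay satisfies the `L^p` bound of its averages. The polynomial growth, whose
degree does not enter the constant, is used only to see that `U ∈ L^p` forces `U` to be bounded,
hence all averages to be finite. -/
lemma eLpNorm_avg_le_of_le_one {M : ℝ} {p : ℝ≥0∞} (hp0 : 0 < p) (hp1 : p ≤ 1)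
    (hM : (Module.finrank ℝ (E × F) : ℝ) < M) (hMp : (Module.finrank ℝ (E × F) : ℝ) < M * p.toReal)
    (C : ℝ → ℝ≥0∞) (hC : ∀ N, C N ≠ ∞) :
    ∃ C' : ℝ≥0∞, C' ≠ ∞ ∧ ∀ U : E × F → ℝ≥0∞, Measurable U →
      (∃ (B : ℝ≥0∞) (m : ℝ), B ≠ ∞ ∧ 0 ≤ m ∧ ∀ w, U w ≤ B * wt w ^ m) →
      (∀ N, 0 ≤ N → ∀ w, U w ≤ C N * avg Φ μ N U w) →
      eLpNorm (avg Φ μ M U) p μ ≤ C' * eLpNorm U p μ := by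
  have hpt : p ≠ ∞ := (hp1.trans_lt ENNReal.one_lt_top).ne
  have hr0 : 0 < p.toReal := ENNReal.toReal_pos hp0.ne' hpt
  have hr1 : p.toReal ≤ 1 := by
    rw [← ENNReal.toReal_one]; exact (ENNReal.toReal_le_toReal hpt ENNReal.one_ne_top).2 hp1
  set r := p.toReal
  have hD : (0 : ℝ) ≤ Module.finrank ℝ (E × F) := Nat.cast_nonneg _
  have hM0 : 0 ≤ M := by linarith
  set A := ENNReal.ofReal (ctrlConst Φ)
  set κ := ∫⁻ v, wt v ^ (-(M * r)) ∂μ with hκ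
  have hκ1 : κ ≠ ∞ := (lintegral_wt_rpow_lt_top μ hMp).ne
  have hfac : ∀ N, 0 ≤ N → (C N * A ^ N) ^ (1 - r) ≠ ∞ := fun N hN =>
    ENNReal.rpow_ne_top_of_nonneg (by linarith) (ENNReal.mul_ne_top (hC N)
      (ENNReal.rpow_ne_top_of_nonneg hN ENNReal.ofReal_ne_top))
  refine ⟨((C M * A ^ M) ^ (1 - r) * κ) ^ (1 / r) + 1, ?_, fun U hUm hgrowth hU => ?_⟩
  · exact ENNReal.add_ne_top.2 ⟨ENNReal.rpow_ne_top_of_nonneg (by positivity)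
      (ENNReal.mul_ne_top (hfac M hM0) hκ1), ENNReal.one_ne_top⟩
  rcases eq_or_ne (eLpNorm U p μ) ∞ with htop | htop
  · rw [htop, ENNReal.mul_top (by simp)]; exact le_top
  rw [eLpNorm_eq_lintegral_rpow_enorm_toReal hp0.ne' hpt] at htop ⊢
  rw [eLpNorm_eq_lintegral_rpow_enorm_toReal hp0.ne' hpt]
  simp only [enorm_eq_self] at htop ⊢
  change (∫⁻ x, U x ^ r ∂μ) ^ (1 / r) ≠ ∞ at htop
  change (∫⁻ x, avg Φ μ M U x ^ r ∂μ) ^ (1 / r) ≤ _ * (∫⁻ x, U x ^ r ∂μ) ^ (1 / r)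
  have hI : ∫⁻ x, U x ^ r ∂μ ≠ ∞ := by
    intro h; rw [h, ENNReal.top_rpow_of_pos (by positivity)] at htop; exact htop rfl
  -- `U` is bounded: for `N` beyond the order of growth of `U` all averages are finite.
  obtain ⟨b, hb, hUb⟩ : ∃ b : ℝ≥0∞, b ≠ ∞ ∧ ∀ w, U w ≤ b := by
    obtain ⟨B, m, hB, hm, hUB⟩ := hgrowth
    set N := Module.finrank ℝ (E × F) + m + 1 with hN
    have hN0 : 0 ≤ N := by positivity
    refine ⟨C N * ((C N * A ^ N) ^ (1 - r) * ∫⁻ x, U x ^ r ∂μ) ^ (1 / r), ?_, fun w => ?_⟩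
    · exact ENNReal.mul_ne_top (hC N) (ENNReal.rpow_ne_top_of_nonneg (by positivity)
        (ENNReal.mul_ne_top (hfac N hN0) hI))
    · refine (hU N hN0 w).trans ?_
      gcongr
      rw [one_div, ENNReal.le_rpow_inv_iff hr0]
      refine (avg_rpow_le Φ μ hN0 hr0 hr1 (hC N) (hU N hN0) w
        (avg_ne_top_of_le_wt Φ μ hm hB (by rw [hN]; linarith) hUB w)).trans ?_
      gcongr
      refine lintegral_mono fun y => ?_
      refine mul_le_of_le_one_right' ?_
      rw [ENNReal.rpow_neg, ENNReal.inv_le_one]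
      exact ENNReal.one_le_rpow (one_le_wt _) (by positivity)
  have hfin : ∀ z, avg Φ μ M U z ≠ ∞ := fun z =>
    avg_ne_top_of_le_wt Φ μ le_rfl hb (by linarith) (fun w => by simpa using hUb w) z
  calc (∫⁻ x, avg Φ μ M U x ^ r ∂μ) ^ (1 / r)
      ≤ (∫⁻ x, (C M * A ^ M) ^ (1 - r) * avg Φ μ (M * r) (fun y => U y ^ r) x ∂μ) ^ (1 / r) := by
        gcongr with x
        exact avg_rpow_le Φ μ hM0 hr0 hr1 (hC M) (hU M hM0) x (hfin x)
    _ = ((C M * A ^ M) ^ (1 - r) * κ) ^ (1 / r) * (∫⁻ x, U x ^ r ∂μ) ^ (1 / r) := by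
        rw [lintegral_const_mul' _ _ (hfac M hM0), lintegral_avg Φ μ _ (hUm.pow_const _),
          ← ENNReal.mul_rpow_of_nonneg _ _ (by positivity)]
        congr 1; ring
    _ ≤ _ := by gcongr; exact le_self_add

end Average

/-! ### Convolution with a Schwartz function -/

section Convolution

variable {E F : Type*} [NormedAddCommGroup E] [InnerProductSpace ℂ E] [FiniteDimensional ℂ E]
  [NormedAddCommGroup F] [InnerProductSpace ℝ F] [FiniteDimensional ℝ F]

lemma schwartz_decay (φ : 𝓢(E × F, ℂ)) (k n : ℕ) :
    ∃ C : ℝ, 0 ≤ C ∧ ∀ v, (1 + ‖v‖) ^ k * ‖iteratedFDeriv ℝ n φ v‖ ≤ C :=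
  ⟨_, by positivity, fun v =>
    SchwartzMap.one_add_le_sup_seminorm_apply (𝕜 := ℝ) (m := (k, n)) le_rfl le_rfl φ v⟩

/-- Passage from real polynomial decay estimates to the weight `wt`. -/
lemma ofReal_le_mul_wt_rpow {N : ℝ} {k : ℕ} (hk : N ≤ k) {v : E × F} {a C : ℝ} (hC : 0 ≤ C)
    (h : (1 + ‖v‖) ^ k * a ≤ C) : ENNReal.ofReal a ≤ ENNReal.ofReal C * wt v ^ (-N) := by
  have h1 : (1 : ℝ) ≤ 1 + ‖v‖ := by linarith [norm_nonneg v]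
  have h0 : (0 : ℝ) < 1 + ‖v‖ := by linarith
  rw [wt, ENNReal.ofReal_rpow_of_pos h0, ← ENNReal.ofReal_mul hC]
  refine ENNReal.ofReal_le_ofReal ?_
  have h2 : a ≤ C * ((1 + ‖v‖) ^ k)⁻¹ := by
    rw [← div_eq_mul_inv, le_div_iff₀' (by positivity)]; exact h
  refine h2.trans ?_
  gcongr
  rw [← Real.rpow_natCast, ← Real.rpow_neg h0.le]
  exact Real.rpow_le_rpow_of_exponent_le h1 (by linarith)

lemma enorm_schwartz_le (φ : 𝓢(E × F, ℂ)) (N : ℝ) :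
    ∃ C : ℝ≥0∞, C ≠ ∞ ∧ ∀ v, ‖φ v‖ₑ ≤ C * wt v ^ (-N) := by
  obtain ⟨C, hC, h⟩ := schwartz_decay φ ⌈N⌉₊ 0
  refine ⟨ENNReal.ofReal C, ENNReal.ofReal_ne_top, fun v => ?_⟩
  rw [← ofReal_norm]
  exact ofReal_le_mul_wt_rpow (Nat.le_ceil N) hC (by simpa using h v)

variable (Φ : HermitianMap E F)

/-- Right translations by small elements move a Schwartz function by a small amount, with rapid
decay. -/
lemma enorm_schwartz_nMul_sub_le (φ : 𝓢(E × F, ℂ)) (N : ℝ) {ρ : ℝ} (hρ : 0 ≤ ρ) :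
    ∃ C : ℝ≥0∞, C ≠ ∞ ∧ ∀ v g : E × F, ‖g‖ ≤ ρ →
      ‖φ (nMul Φ v g) - φ v‖ₑ ≤ C * ENNReal.ofReal ‖g‖ * wt v ^ (-N) := by
  obtain ⟨C, hC, h⟩ := schwartz_decay φ (⌈N⌉₊ + 1) 1
  set k := ⌈N⌉₊
  set A := ctrlConst Φ with hA
  have hA1 : 1 ≤ A := one_le_ctrlConst Φ
  set C' := C * (A * (1 + ρ)) ^ (k + 1) * A with hC'
  have hC'0 : 0 ≤ C' := by positivity
  refine ⟨ENNReal.ofReal C', ENNReal.ofReal_ne_top, fun v g hg => ?_⟩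
  rw [← ofReal_norm, ← ENNReal.ofReal_mul hC'0]
  refine ofReal_le_mul_wt_rpow (Nat.le_ceil N) (by positivity) ?_
  have hv0 : 0 < 1 + ‖v‖ := by positivity
  -- The segment from `v` to `v · g` consists of the points `v · (t g)`, at which the weight is
  -- comparable to the one at `v`.
  have hseg : ∀ x ∈ segment ℝ v (nMul Φ v g),
      ‖fderiv ℝ φ x‖ ≤ C * (A * (1 + ρ)) ^ (k + 1) / (1 + ‖v‖) ^ (k + 1) := by
    intro x hx
    rw [segment_eq_image'] at hx
    obtain ⟨t, ht, rfl⟩ := hx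
    have hx1 : v + t • (nMul Φ v g - v) = nMul Φ v (t • g) := by
      ext
      · simp [nMul]
      · simp only [nMul, Prod.snd_add, Prod.smul_snd, Prod.snd_sub, Prod.smul_fst,
          Φ.im_smul_right, smul_sub, smul_add, smul_comm t (2 : ℝ)]
        abel
    have hx2 : nMul Φ (nMul Φ v (t • g)) (-(t • g)) = v := by
      rw [nMul_assoc, ← nInv_eq_neg]
      have h1 := nMul_nInv_nMul Φ (t • g) 0
      have h2 : nMul Φ (nInv (t • g)) 0 = nInv (t • g) := by simp [nMul, HermitianMap.im]
      rw [h2] at h1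
      rw [h1]
      simp [nMul, HermitianMap.im]
    have hx3 := one_add_norm_nMul_le Φ (nMul Φ v (t • g)) (-(t • g))
    rw [hx2, norm_neg, norm_smul, Real.norm_of_nonneg ht.1] at hx3
    simp only
    rw [hx1, le_div_iff₀' (by positivity)]
    set x := nMul Φ v (t • g)
    have hx4 := h x
    rw [norm_iteratedFDeriv_one] at hx4
    have hx5 : 1 + ‖v‖ ≤ A * (1 + ρ) * (1 + ‖x‖) := by
      refine hx3.trans ?_
      have : 1 + t * ‖g‖ ≤ 1 + ρ := by nlinarith [ht.2, norm_nonneg g]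
      calc A * (1 + ‖x‖) * (1 + t * ‖g‖) ≤ A * (1 + ‖x‖) * (1 + ρ) := by gcongr
        _ = _ := by ring
    calc (1 + ‖v‖) ^ (k + 1) * ‖fderiv ℝ φ x‖
        ≤ (A * (1 + ρ) * (1 + ‖x‖)) ^ (k + 1) * ‖fderiv ℝ φ x‖ := by gcongr
      _ = (A * (1 + ρ)) ^ (k + 1) * ((1 + ‖x‖) ^ (k + 1) * ‖fderiv ℝ φ x‖) := by
          rw [mul_pow]; ring
      _ ≤ (A * (1 + ρ)) ^ (k + 1) * C := by gcongr
      _ = _ := by ring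
  have hmv := Convex.norm_image_sub_le_of_norm_fderiv_le (𝕜 := ℝ) (f := φ)
    (fun x _ => φ.differentiableAt) hseg (convex_segment _ _) (left_mem_segment ℝ _ _)
    (right_mem_segment ℝ _ _)
  have hdiff : ‖nMul Φ v g - v‖ ≤ A * ‖g‖ * (1 + ‖v‖) := by
    have h1 : nMul Φ v g - v = (g.1, g.2 + (2 : ℝ) • Φ.im v.1 g.1) := by
      ext <;> simp [nMul]; abel
    have h5 := Φ.norm_im_le v.1 g.1
    have h6 : ‖Φ.imCLM‖ * ‖v.1‖ * ‖g.1‖ ≤ ‖Φ.imCLM‖ * ‖v‖ * ‖g‖ := by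
      gcongr
      exacts [norm_fst_le v, norm_fst_le g]
    have h7 : 0 ≤ ‖Φ.imCLM‖ * ‖v‖ * ‖g‖ := by positivity
    have h8 : 0 ≤ ‖Φ.imCLM‖ * ‖g‖ := by positivity
    have h9 : 0 ≤ ‖v‖ * ‖g‖ := by positivity
    have h10 : A * ‖g‖ * (1 + ‖v‖) = ‖g‖ + ‖v‖ * ‖g‖ + 2 * (‖Φ.imCLM‖ * ‖g‖) +
        2 * (‖Φ.imCLM‖ * ‖v‖ * ‖g‖) := by rw [hA, ctrlConst]; ring
    rw [h1, h10, Prod.norm_def]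
    refine max_le ?_ ?_
    · have := norm_fst_le g
      simp only; linarith
    · calc ‖g.2 + (2 : ℝ) • Φ.im v.1 g.1‖ ≤ ‖g.2‖ + ‖(2 : ℝ) • Φ.im v.1 g.1‖ := norm_add_le _ _
        _ = ‖g.2‖ + 2 * ‖Φ.im v.1 g.1‖ := by rw [norm_smul]; norm_num
        _ ≤ _ := by linarith [norm_snd_le g]
  calc (1 + ‖v‖) ^ k * ‖φ (nMul Φ v g) - φ v‖
      ≤ (1 + ‖v‖) ^ k * (C * (A * (1 + ρ)) ^ (k + 1) / (1 + ‖v‖) ^ (k + 1) *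
          (A * ‖g‖ * (1 + ‖v‖))) := by gcongr; exact hmv.trans (by gcongr)
    _ = C' * ‖g‖ := by rw [hC', pow_succ (1 + ‖v‖)]; field_simp

/-! ### Growth and continuity of the convolution -/

/-- The Schwartz seminorms of the translates `y ↦ φ(y⁻¹ x)` grow at most polynomially in `x`. -/
lemma norm_iteratedFDeriv_reflTranslate_le (φ : 𝓢(E × F, ℂ)) (k n : ℕ) :
    ∃ C : ℝ, 0 ≤ C ∧ ∀ x y : E × F,
      ‖y‖ ^ k * ‖iteratedFDeriv ℝ n (reflTranslate Φ φ x) y‖ ≤ C * (1 + ‖x‖) ^ (k + n) := by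
  obtain ⟨C, hC, h⟩ := schwartz_decay φ k n
  set A := ctrlConst Φ with hA
  have hA1 : 1 ≤ A := one_le_ctrlConst Φ
  refine ⟨A ^ (k + n) * C, by positivity, fun x y => ?_⟩
  let L : (E × F) →L[ℝ] (E × F) := ((reflLin Φ x).toContinuousLinearEquiv : _ →L[ℝ] _)
  have hLapp : ∀ y, L y = (-y.1, -y.2 - (2 : ℝ) • Φ.im y.1 x.1) := fun y => rfl
  have hL : ‖L‖ ≤ A * (1 + ‖x‖) := by
    refine L.opNorm_le_bound (by positivity) fun y => ?_
    have h5 := Φ.norm_im_le y.1 x.1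
    have h6 : ‖Φ.imCLM‖ * ‖y.1‖ * ‖x.1‖ ≤ ‖Φ.imCLM‖ * ‖y‖ * ‖x‖ := by
      gcongr
      exacts [norm_fst_le y, norm_fst_le x]
    have h7 : 0 ≤ ‖Φ.imCLM‖ * ‖y‖ * ‖x‖ := by positivity
    have h8 : 0 ≤ ‖Φ.imCLM‖ * ‖y‖ := by positivity
    have h9 : 0 ≤ ‖x‖ * ‖y‖ := by positivity
    have h10 : A * (1 + ‖x‖) * ‖y‖ = ‖y‖ + ‖x‖ * ‖y‖ + 2 * (‖Φ.imCLM‖ * ‖y‖) +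
        2 * (‖Φ.imCLM‖ * ‖y‖ * ‖x‖) := by rw [hA, ctrlConst]; ring
    rw [hLapp, h10, Prod.norm_def]
    refine max_le ?_ ?_
    · have := norm_fst_le y
      simp only [norm_neg]; linarith
    · calc ‖-y.2 - (2 : ℝ) • Φ.im y.1 x.1‖ ≤ ‖-y.2‖ + ‖(2 : ℝ) • Φ.im y.1 x.1‖ := norm_sub_le _ _
        _ = ‖y.2‖ + 2 * ‖Φ.im y.1 x.1‖ := by rw [norm_smul, norm_neg]; norm_num
        _ ≤ _ := by linarith [norm_snd_le y]
  have hf : (reflTranslate Φ φ x : E × F → ℂ) = (fun v => φ (v + x)) ∘ L := by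
    ext y
    change φ (L y - -x) = φ (L y + x)
    rw [sub_neg_eq_add]
  have hLx : L y + x = nMul Φ (nInv y) x := by
    rw [hLapp]
    ext
    · simp [nMul, nInv]
    · simp [nMul, nInv, Φ.im_neg_left]; abel
  have hy : ‖y‖ ≤ A * (1 + ‖x‖) * (1 + ‖L y + x‖) := by
    have h1 : nMul Φ x (nInv (L y + x)) = y := by
      rw [hLx, nInv_nMul, nMul_nInv_nMul]; simp [nInv]
    have h2 := one_add_norm_nMul_le Φ x (nInv (L y + x))
    rw [h1, nInv_eq_neg, norm_neg] at h2
    linarith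
  rw [hf, L.iteratedFDeriv_comp_right (n := n) (f := fun v => φ (v + x))
    ((φ.smooth n).comp (contDiff_id.add contDiff_const)) y le_rfl, iteratedFDeriv_comp_add_right]
  have hcomp := ContinuousMultilinearMap.norm_compContinuousLinearMap_le
    (iteratedFDeriv ℝ n φ (L y + x)) (fun _ => L)
  rw [Finset.prod_const, Finset.card_univ, Fintype.card_fin] at hcomp
  calc _ ≤ (A * (1 + ‖x‖) * (1 + ‖L y + x‖)) ^ k *
        (‖iteratedFDeriv ℝ n φ (L y + x)‖ * (A * (1 + ‖x‖)) ^ n) := by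
        gcongr
        exact hcomp.trans (by gcongr)
    _ = A ^ (k + n) * (1 + ‖x‖) ^ (k + n) *
        ((1 + ‖L y + x‖) ^ k * ‖iteratedFDeriv ℝ n φ (L y + x)‖) := by
        rw [mul_pow, mul_pow, mul_pow, pow_add, pow_add]; ring
    _ ≤ A ^ (k + n) * (1 + ‖x‖) ^ (k + n) * C := by gcongr; exact h _
    _ = _ := by ring

lemma norm_conv_le (u : 𝓢'(E × F, ℂ)) (φ : 𝓢(E × F, ℂ)) :
    ∃ (C : ℝ) (m : ℕ), 0 ≤ C ∧ ∀ x, ‖conv Φ u φ x‖ ≤ C * (1 + ‖x‖) ^ m := by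
  let q : Seminorm ℂ 𝓢(E × F, ℂ) := (normSeminorm ℂ ℂ).comp u.toLinearMap
  have hq : Continuous q := (map_continuous u).norm
  obtain ⟨s, c, -, hle⟩ := Seminorm.bound_of_continuous (schwartz_withSeminorms ℂ (E × F) ℂ) q hq
  choose C hC h using fun i : ℕ × ℕ => norm_iteratedFDeriv_reflTranslate_le Φ φ i.1 i.2
  refine ⟨c * ∑ i ∈ s, C i, ∑ i ∈ s, (i.1 + i.2),
    mul_nonneg c.2 (Finset.sum_nonneg fun i _ => hC i), fun x => ?_⟩
  have h1 : ‖conv Φ u φ x‖ ≤ c * (s.sup (schwartzSeminormFamily ℂ (E × F) ℂ))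
      (reflTranslate Φ φ x) := hle (reflTranslate Φ φ x)
  refine h1.trans ?_
  rw [mul_assoc]
  refine mul_le_mul_of_nonneg_left ?_ c.2
  have hx1 : 1 ≤ 1 + ‖x‖ := by linarith [norm_nonneg x]
  have hs0 : 0 ≤ ∑ i ∈ s, C i := Finset.sum_nonneg fun i _ => hC i
  refine Seminorm.finset_sup_apply_le (by positivity) fun i hi => ?_
  refine SchwartzMap.seminorm_le_bound ℂ i.1 i.2 _ (by positivity) fun y => (h i x y).trans ?_
  refine mul_le_mul (Finset.single_le_sum (fun j _ => hC j) hi)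
    (pow_le_pow_right₀ hx1 (Finset.single_le_sum (f := fun j : ℕ × ℕ => j.1 + j.2)
      (fun j _ => Nat.zero_le _) hi)) (by positivity) hs0

lemma continuous_iteratedFDeriv_reflTranslate (φ : 𝓢(E × F, ℂ)) (n : ℕ) :
    Continuous fun q : (E × F) × (E × F) => iteratedFDeriv ℝ n (reflTranslate Φ φ q.1) q.2 := by
  -- The derivatives in `y` are restrictions of those of `(x, y) ↦ φ(y⁻¹ x)`.
  let Ψ : (E × F) × (E × F) → ℂ := fun q => φ (nMul Φ (nInv q.2) q.1)
  have hΨ : ContDiff ℝ n Ψ := by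
    have him : ContDiff ℝ n fun q : (E × F) × (E × F) => Φ.imCLM (-q.2.1) q.1.1 := by fun_prop
    refine (φ.smooth n).comp (ContDiff.prodMk ?_ ?_)
    · exact (by fun_prop : ContDiff ℝ n fun q : (E × F) × (E × F) => -q.2.1 + q.1.1)
    · exact (by fun_prop : ContDiff ℝ n fun q : (E × F) × (E × F) => -q.2.2 + q.1.2).add
        (him.const_smul (2 : ℝ))
  have hD : ∀ q : (E × F) × (E × F), iteratedFDeriv ℝ n (reflTranslate Φ φ q.1) q.2 =
      (iteratedFDeriv ℝ n Ψ q).compContinuousLinearMap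
        fun _ => ContinuousLinearMap.inr ℝ (E × F) (E × F) := by
    rintro ⟨x, y⟩
    have hf : (reflTranslate Φ φ x : E × F → ℂ) =
        (fun q => Ψ ((x, 0) + q)) ∘ ContinuousLinearMap.inr ℝ (E × F) (E × F) := by
      ext y; simp [Ψ, reflTranslate_apply]
    simp only
    rw [hf, ContinuousLinearMap.iteratedFDeriv_comp_right (n := n) _
      (f := fun q => Ψ ((x, 0) + q)) (hΨ.comp (contDiff_const.add contDiff_id)) y le_rfl,
      iteratedFDeriv_comp_add_left]
    simp
  simp_rw [hD]
  exact (ContinuousMultilinearMap.compContinuousLinearMapL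
    fun _ => ContinuousLinearMap.inr ℝ (E × F) (E × F)).continuous.comp
      (hΨ.continuous_iteratedFDeriv le_rfl)

/-- The translates `y ↦ φ(y⁻¹ x)` depend continuously on `x`: away from a large ball the seminorms
of the differences are small by the uniform decay, and on this ball by joint continuity. -/
lemma continuous_reflTranslate (φ : 𝓢(E × F, ℂ)) : Continuous (reflTranslate Φ φ) := by
  rw [continuous_iff_continuousAt]
  intro x₀
  rw [ContinuousAt, (schwartz_withSeminorms ℂ (E × F) ℂ).tendsto_nhds]
  rintro ⟨k, n⟩ ε hε
  obtain ⟨C, hC, h⟩ := norm_iteratedFDeriv_reflTranslate_le Φ φ (k + 1) n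
  set B := C * (2 + ‖x₀‖) ^ (k + 1 + n) with hB
  have hB0 : 0 ≤ B := by positivity
  have hdiff : ∀ x y, iteratedFDeriv ℝ n (reflTranslate Φ φ x - reflTranslate Φ φ x₀ : 𝓢(_, _)) y =
      iteratedFDeriv ℝ n (reflTranslate Φ φ x) y - iteratedFDeriv ℝ n (reflTranslate Φ φ x₀) y := by
    intro x y
    exact iteratedFDeriv_sub_apply ((reflTranslate Φ φ x).smooth n).contDiffAt
      ((reflTranslate Φ φ x₀).smooth n).contDiffAt
  set r := 4 * B / ε + 1 with hr
  have hr0 : 0 < r := by positivity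
  have hcpt : ∀ᶠ x in nhds x₀, ∀ y ∈ Metric.closedBall (0 : E × F) r,
      ‖y‖ ^ k * ‖iteratedFDeriv ℝ n (reflTranslate Φ φ x - reflTranslate Φ φ x₀ : 𝓢(_, _)) y‖
        < ε / 2 := by
    have : FiniteDimensional ℝ E := FiniteDimensional.complexToReal E
    have : ProperSpace (E × F) := FiniteDimensional.proper_real (E × F)
    refine (isCompact_closedBall (0 : E × F) r).eventually_forall_of_forall_eventually
      (P := fun x y => ‖y‖ ^ k * ‖iteratedFDeriv ℝ n
        (reflTranslate Φ φ x - reflTranslate Φ φ x₀ : 𝓢(_, _)) y‖ < ε / 2) fun y _ => ?_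
    simp_rw [hdiff]
    have hc1 := continuous_iteratedFDeriv_reflTranslate Φ φ n
    have hc2 : Continuous fun q : (E × F) × (E × F) =>
        iteratedFDeriv ℝ n (reflTranslate Φ φ x₀) q.2 :=
      (((reflTranslate Φ φ x₀).smooth n).continuous_iteratedFDeriv le_rfl).comp continuous_snd
    have hc : Continuous fun q : (E × F) × (E × F) => ‖q.2‖ ^ k *
        ‖iteratedFDeriv ℝ n (reflTranslate Φ φ q.1) q.2 -
          iteratedFDeriv ℝ n (reflTranslate Φ φ x₀) q.2‖ :=
      (continuous_snd.norm.pow k).mul (hc1.sub hc2).norm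
    have h0 : ‖y‖ ^ k * ‖iteratedFDeriv ℝ n (reflTranslate Φ φ x₀) y -
        iteratedFDeriv ℝ n (reflTranslate Φ φ x₀) y‖ < ε / 2 := by
      rw [sub_self, norm_zero, mul_zero]; exact half_pos hε
    exact (hc.tendsto (x₀, y)).eventually_lt_const h0
  filter_upwards [hcpt, Metric.ball_mem_nhds x₀ one_pos] with x hx hx1
  refine lt_of_le_of_lt ?_ (half_lt_self hε)
  refine SchwartzMap.seminorm_le_bound ℂ k n _ (by positivity) fun y => ?_
  rcases le_or_gt ‖y‖ r with hy | hy
  · exact (hx y (by simpa using hy)).le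
  · have hxn : ‖x‖ ≤ 1 + ‖x₀‖ := by
      have h1 : ‖x - x₀‖ < 1 := by simpa [dist_eq_norm] using hx1
      have h2 := norm_add_le (x - x₀) x₀
      rw [sub_add_cancel] at h2
      linarith
    have h1 : ‖y‖ ^ (k + 1) * ‖iteratedFDeriv ℝ n (reflTranslate Φ φ x) y‖ ≤ B :=
      (h x y).trans (mul_le_mul_of_nonneg_left
        (pow_le_pow_left₀ (by positivity) (by linarith : 1 + ‖x‖ ≤ 2 + ‖x₀‖) _) hC)
    have h2 : ‖y‖ ^ (k + 1) * ‖iteratedFDeriv ℝ n (reflTranslate Φ φ x₀) y‖ ≤ B :=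
      (h x₀ y).trans (mul_le_mul_of_nonneg_left
        (pow_le_pow_left₀ (by positivity) (by linarith : 1 + ‖x₀‖ ≤ 2 + ‖x₀‖) _) hC)
    have h3 : ‖y‖ ^ (k + 1) *
        ‖iteratedFDeriv ℝ n (reflTranslate Φ φ x - reflTranslate Φ φ x₀ : 𝓢(_, _)) y‖ ≤ 2 * B := by
      rw [hdiff]
      refine (mul_le_mul_of_nonneg_left (norm_sub_le _ _) (by positivity)).trans ?_
      rw [mul_add]; linarith
    have hy0 : 0 < ‖y‖ := hr0.trans hy
    have h4 : 2 * B ≤ ε / 2 * ‖y‖ := by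
      have : 4 * B / ε ≤ ‖y‖ := by linarith
      rw [div_le_iff₀ hε] at this
      linarith
    rw [pow_succ] at h3
    have h5 : (‖y‖ ^ k *
        ‖iteratedFDeriv ℝ n (reflTranslate Φ φ x - reflTranslate Φ φ x₀ : 𝓢(_, _)) y‖) * ‖y‖ ≤
        ε / 2 * ‖y‖ := by linarith
    exact le_of_mul_le_mul_right h5 hy0

lemma continuous_conv (u : 𝓢'(E × F, ℂ)) (φ : 𝓢(E × F, ℂ)) : Continuous (conv Φ u φ) :=
  (map_continuous u).comp (continuous_reflTranslate Φ φ)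

end Convolution

/-! ### Pointwise domination of the elements of `O(φ)` -/

section Domination

variable {E F : Type*} [NormedAddCommGroup E] [InnerProductSpace ℂ E] [FiniteDimensional ℂ E]
  [MeasurableSpace E] [BorelSpace E]
  [NormedAddCommGroup F] [InnerProductSpace ℝ F] [FiniteDimensional ℝ F]
  [MeasurableSpace F] [BorelSpace F]
  (Φ : HermitianMap E F) (μ : Measure (E × F)) [μ.IsAddHaarMeasure]

lemma measurable_enorm_conv (u : 𝓢'(E × F, ℂ)) (φ : 𝓢(E × F, ℂ)) :
    Measurable fun x => ‖conv Φ u φ x‖ₑ :=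
  (continuous_conv Φ u φ).measurable.enorm

lemma enorm_conv_le_wt (u : 𝓢'(E × F, ℂ)) (φ : 𝓢(E × F, ℂ)) :
    ∃ (B : ℝ≥0∞) (m : ℝ), B ≠ ∞ ∧ 0 ≤ m ∧ ∀ x, ‖conv Φ u φ x‖ₑ ≤ B * wt x ^ m := by
  obtain ⟨C, m, hC, h⟩ := norm_conv_le Φ u φ
  refine ⟨ENNReal.ofReal C, m, ENNReal.ofReal_ne_top, m.cast_nonneg, fun x => ?_⟩
  rw [ENNReal.rpow_natCast, wt, ← ENNReal.ofReal_pow (by positivity), ← ENNReal.ofReal_mul hC,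
    ← ofReal_norm]
  exact ENNReal.ofReal_le_ofReal (h x)

/-- The reproducing formula: testing the definition of `O(φ)` against a translate of `φ`. -/
lemma conv_eq_integral {u : 𝓢'(E × F, ℂ)} {φ : 𝓢(E × F, ℂ)} (hu : u ∈ spaceO Φ μ φ) (w : E × F) :
    conv Φ u φ w = ∫ y, conv Φ u φ y * φ (nMul Φ (nInv y) w) ∂μ := by
  have h := hu (reflTranslate Φ φ w)
  simp_rw [reflTranslate_apply] at h
  exact h

lemma lintegral_mul_mul_wt_eq (a : ℝ≥0∞) (ha : a ≠ ∞) (N : ℝ) (U : E × F → ℝ≥0∞) (w : E × F) :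
    ∫⁻ y, U y * (a * wt (nMul Φ (nInv y) w) ^ (-N)) ∂μ = a * avg Φ μ N U w := by
  rw [avg, ← lintegral_const_mul' _ _ ha]
  exact lintegral_congr fun y => by ring

lemma enorm_conv_le_avg (φ : 𝓢(E × F, ℂ)) (N : ℝ) :
    ∃ C : ℝ≥0∞, C ≠ ∞ ∧ ∀ u ∈ spaceO Φ μ φ, ∀ w,
      ‖conv Φ u φ w‖ₑ ≤ C * avg Φ μ N (fun y => ‖conv Φ u φ y‖ₑ) w := by
  obtain ⟨C, hC, h⟩ := enorm_schwartz_le φ N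
  refine ⟨C, hC, fun u hu w => ?_⟩
  rw [conv_eq_integral Φ μ hu w, ← lintegral_mul_mul_wt_eq Φ μ C hC]
  refine (enorm_integral_le_lintegral_enorm _).trans (lintegral_mono fun y => ?_)
  rw [enorm_mul]
  gcongr
  exact h _

lemma integrable_conv_mul (u : 𝓢'(E × F, ℂ)) (φ : 𝓢(E × F, ℂ)) (w : E × F) :
    Integrable (fun y => conv Φ u φ y * φ (nMul Φ (nInv y) w)) μ := by
  obtain ⟨B, m, hB, hm, hU⟩ := enorm_conv_le_wt Φ u φ
  obtain ⟨C, hC, h⟩ := enorm_schwartz_le φ (Module.finrank ℝ (E × F) + m + 1)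
  have hc : Continuous fun y => φ (nMul Φ (nInv y) w) :=
    φ.continuous.comp ((continuous_nMul Φ).comp
      (continuous_neg.prodMk continuous_const : Continuous fun y : E × F => (nInv y, w)))
  refine ⟨((continuous_conv Φ u φ).mul hc).aestronglyMeasurable, ?_⟩
  rw [HasFiniteIntegral]
  calc ∫⁻ y, ‖conv Φ u φ y * φ (nMul Φ (nInv y) w)‖ₑ ∂μ
      ≤ ∫⁻ y, ‖conv Φ u φ y‖ₑ * (C * wt (nMul Φ (nInv y) w) ^
          (-((Module.finrank ℝ (E × F) : ℝ) + m + 1))) ∂μ := by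
        refine lintegral_mono fun y => ?_
        rw [enorm_mul]
        gcongr
        exact h _
    _ < ∞ := by
        rw [lintegral_mul_mul_wt_eq Φ μ C hC]
        exact ENNReal.mul_lt_top hC.lt_top
          (avg_ne_top_of_le_wt Φ μ hm hB (by linarith) hU w).lt_top

lemma enorm_conv_nMul_sub_le_avg (φ : 𝓢(E × F, ℂ)) (N : ℝ) {ρ : ℝ} (hρ : 0 ≤ ρ) :
    ∃ C : ℝ≥0∞, C ≠ ∞ ∧ ∀ u ∈ spaceO Φ μ φ, ∀ w g, ‖g‖ ≤ ρ →
      ‖conv Φ u φ (nMul Φ w g) - conv Φ u φ w‖ₑ ≤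
        C * ENNReal.ofReal ‖g‖ * avg Φ μ N (fun y => ‖conv Φ u φ y‖ₑ) w := by
  obtain ⟨C, hC, h⟩ := enorm_schwartz_nMul_sub_le Φ φ N hρ
  refine ⟨C, hC, fun u hu w g hg => ?_⟩
  rw [conv_eq_integral Φ μ hu w, conv_eq_integral Φ μ hu (nMul Φ w g),
    ← integral_sub (integrable_conv_mul Φ μ u φ _) (integrable_conv_mul Φ μ u φ _),
    ← lintegral_mul_mul_wt_eq Φ μ _ (ENNReal.mul_ne_top hC ENNReal.ofReal_ne_top)]
  refine (enorm_integral_le_lintegral_enorm _).trans (lintegral_mono fun y => ?_)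
  rw [← mul_sub, enorm_mul, ← nMul_assoc]
  gcongr
  exact h _ _ hg

/-- Elements of `O(φ)` and their oscillations are controlled by a single function `H`, whose `L^p`
norm is controlled by that of `u`. This is the only place where the exponent `p` matters. -/
theorem exists_dominating (φ : 𝓢(E × F, ℂ)) {p : ℝ≥0∞} (hp : 0 < p) {ρ : ℝ} (hρ : 0 ≤ ρ) :
    ∃ C : NNReal, ∀ u ∈ spaceO Φ μ φ, ∃ H : E × F → ℝ≥0∞, Measurable H ∧
      eLpNorm H p μ ≤ C * eLpNorm (conv Φ u φ) p μ ∧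
      (∀ w z, ‖nMul Φ (nInv w) z‖ ≤ ρ → ‖conv Φ u φ w‖ₑ ≤ C * H z) ∧
      (∀ w g, ‖g‖ ≤ ρ → ‖conv Φ u φ (nMul Φ w g) - conv Φ u φ w‖ₑ ≤
        C * ENNReal.ofReal ‖g‖ * H w) := by
  set D : ℝ := ((Module.finrank ℝ (E × F) : ℕ) : ℝ) with hD
  have hD0 : 0 ≤ D := Nat.cast_nonneg _
  choose C₁ hC₁ h₁ using fun N => enorm_conv_le_avg Φ μ φ N
  -- An exponent `M` for which the averages are bounded on `L^p`: for `p < 1` the weight to the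
  -- power `-M p` has to be integrable.
  obtain ⟨M, C₀, hM0, hC₀, h₀⟩ : ∃ (M : ℝ) (C₀ : ℝ≥0∞), 0 ≤ M ∧ C₀ ≠ ∞ ∧ ∀ u ∈ spaceO Φ μ φ,
      eLpNorm (avg Φ μ M fun y => ‖conv Φ u φ y‖ₑ) p μ ≤ C₀ * eLpNorm (conv Φ u φ) p μ := by
    rcases le_total 1 p with hp1 | hp1
    · refine ⟨D + 1, ∫⁻ v, wt v ^ (-(D + 1)) ∂μ, by positivity,
        (lintegral_wt_rpow_lt_top μ (by linarith)).ne, fun u _ => ?_⟩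
      rw [← eLpNorm_enorm (conv Φ u φ)]
      exact eLpNorm_avg_le_of_one_le Φ μ (by linarith) (measurable_enorm_conv Φ u φ) hp1
    · have hpt : p ≠ ∞ := (hp1.trans_lt ENNReal.one_lt_top).ne
      have hr0 : 0 < p.toReal := ENNReal.toReal_pos hp.ne' hpt
      have hr1 : p.toReal ≤ 1 := by
        rw [← ENNReal.toReal_one]
        exact (ENNReal.toReal_le_toReal hpt ENNReal.one_ne_top).2 hp1
      have hle : D + 1 ≤ (D + 1) / p.toReal := by
        rw [le_div_iff₀ hr0]; nlinarith
      obtain ⟨C', hC', h'⟩ := eLpNorm_avg_le_of_le_one Φ μ (M := (D + 1) / p.toReal) hp hp1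
        (by linarith) (by rw [div_mul_cancel₀ _ hr0.ne']; linarith) C₁ hC₁
      refine ⟨(D + 1) / p.toReal, C', by positivity, hC', fun u hu => ?_⟩
      rw [← eLpNorm_enorm (conv Φ u φ)]
      exact h' _ (measurable_enorm_conv Φ u φ) (enorm_conv_le_wt Φ u φ)
        fun N _ w => h₁ N u hu w
  obtain ⟨C₂, hC₂, h₂⟩ := enorm_conv_nMul_sub_le_avg Φ μ φ M hρ
  set a := (ENNReal.ofReal (ctrlConst Φ) * ENNReal.ofReal (1 + ρ)) ^ M with ha
  have ha1 : a ≠ ∞ := ENNReal.rpow_ne_top_of_nonneg hM0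
    (ENNReal.mul_ne_top ENNReal.ofReal_ne_top ENNReal.ofReal_ne_top)
  have hCt : C₀ + C₁ M * a + C₂ ≠ ∞ := ENNReal.add_ne_top.2
    ⟨ENNReal.add_ne_top.2 ⟨hC₀, ENNReal.mul_ne_top (hC₁ M) ha1⟩, hC₂⟩
  refine ⟨(C₀ + C₁ M * a + C₂).toNNReal, fun u hu => ⟨avg Φ μ M fun y => ‖conv Φ u φ y‖ₑ,
    measurable_avg Φ μ M (measurable_enorm_conv Φ u φ), ?_, fun w z hwz => ?_, fun w g hg => ?_⟩⟩
  · rw [ENNReal.coe_toNNReal hCt]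
    refine (h₀ u hu).trans ?_
    gcongr
    rw [add_assoc]; exact le_self_add
  · rw [ENNReal.coe_toNNReal hCt]
    calc ‖conv Φ u φ w‖ₑ ≤ C₁ M * avg Φ μ M (fun y => ‖conv Φ u φ y‖ₑ) w := h₁ M u hu w
      _ ≤ C₁ M * (a * avg Φ μ M (fun y => ‖conv Φ u φ y‖ₑ) z) := by
          gcongr
          refine (avg_le_mul_avg Φ μ hM0 _ w z).trans (mul_le_mul_left (ENNReal.rpow_le_rpow
            (mul_le_mul_right (ENNReal.ofReal_le_ofReal (by linarith)) _) hM0) _)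
      _ = C₁ M * a * avg Φ μ M (fun y => ‖conv Φ u φ y‖ₑ) z := by ring
      _ ≤ _ := by gcongr; exact le_add_self.trans le_self_add
  · rw [ENNReal.coe_toNNReal hCt]
    refine (h₂ u hu w g hg).trans ?_
    gcongr
    exact le_add_self

end Domination

/-! ### Discretization over families of sets -/

section Discretization

variable {X J : Type*} [MeasurableSpace X] {μ : Measure X}

lemma ellNorm_mono {p : ℝ≥0∞} {a b : J → ℝ≥0∞} (h : ∀ j, a j ≤ b j) :
    ellNorm p a ≤ ellNorm p b := by
  unfold ellNorm
  split_ifs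
  · exact iSup_mono h
  · gcongr with j
    exact h j

/-- A family dominated by a function on disjoint sets of fixed measure has an `ℓ^p` norm dominated
by the `L^p` norm of the function. -/
lemma ellNorm_le_eLpNorm [Countable J] {p : ℝ≥0∞} (hp : 0 < p) {B : J → Set X}
    (hB : ∀ j, MeasurableSet (B j)) (hd : Pairwise fun j k => Disjoint (B j) (B k))
    {V : ℝ≥0∞} (hV0 : V ≠ 0) (hV : ∀ j, μ (B j) = V) {a : J → ℝ≥0∞} {g : X → ℝ≥0∞}
    (h : ∀ j, ∀ y ∈ B j, a j ≤ g y) :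
    V ^ p⁻¹.toReal * ellNorm p a ≤ eLpNorm g p μ := by
  rcases eq_or_ne p ∞ with rfl | hp'
  · simp only [ENNReal.inv_top, ENNReal.toReal_zero, ENNReal.rpow_zero, one_mul, ellNorm, if_true]
    refine iSup_le fun j => le_of_not_gt fun hlt => ?_
    have h1 : ∀ᵐ y ∂μ, y ∉ B j := by
      filter_upwards [enorm_ae_le_eLpNormEssSup g μ] with y hy hyB
      exact absurd ((h j y hyB).trans hy) (not_le.2 hlt)
    exact hV0 ((hV j).symm.trans (by simpa [ae_iff] using h1))
  · have hr : 0 < p.toReal := ENNReal.toReal_pos hp.ne' hp'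
    rw [eLpNorm_eq_lintegral_rpow_enorm_toReal hp.ne' hp', ellNorm, if_neg hp',
      ENNReal.toReal_inv, one_div, ← ENNReal.mul_rpow_of_nonneg _ _ (by positivity)]
    gcongr
    simp only [enorm_eq_self]
    rw [← ENNReal.tsum_mul_left]
    calc ∑' j, V * a j ^ p.toReal ≤ ∑' j, ∫⁻ y in B j, g y ^ p.toReal ∂μ := by
          refine ENNReal.tsum_le_tsum fun j => ?_
          rw [← hV j, mul_comm, ← setLIntegral_const]
          exact setLIntegral_mono' (hB j) fun y hy => ENNReal.rpow_le_rpow (h j y hy) hr.le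
      _ = ∫⁻ y in ⋃ j, B j, g y ^ p.toReal ∂μ := (lintegral_iUnion hB hd _).symm
      _ ≤ ∫⁻ y, g y ^ p.toReal ∂μ := setLIntegral_le_lintegral _ _

/-- The supremum at `x` of the values of a family attached to sets containing `x`. -/
noncomputable def stepSup (B : J → Set X) (a : J → ℝ≥0∞) (x : X) : ℝ≥0∞ :=
  ⨆ j, (B j).indicator (fun _ => a j) x

lemma le_stepSup {B : J → Set X} (a : J → ℝ≥0∞) {j : J} {x : X} (hx : x ∈ B j) :
    a j ≤ stepSup B a x := by
  refine le_trans ?_ (le_iSup _ j)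
  rw [Set.indicator_of_mem hx]

lemma measurable_stepSup [Countable J] {B : J → Set X} (hB : ∀ j, MeasurableSet (B j))
    (a : J → ℝ≥0∞) : Measurable (stepSup B a) :=
  Measurable.iSup fun j => measurable_const.indicator (hB j)

/-- No disjointness is needed, as the supremum to the power `p` is at most the sum. -/
lemma eLpNorm_stepSup_le [Countable J] {p : ℝ≥0∞} (hp : 0 < p) {B : J → Set X}
    (hB : ∀ j, MeasurableSet (B j)) {V : ℝ≥0∞} (hV : ∀ j, μ (B j) = V) (a : J → ℝ≥0∞) :
    eLpNorm (stepSup B a) p μ ≤ V ^ p⁻¹.toReal * ellNorm p a := by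
  rcases eq_or_ne p ∞ with rfl | hp'
  · simp only [ENNReal.inv_top, ENNReal.toReal_zero, ENNReal.rpow_zero, one_mul, ellNorm, if_true]
    refine eLpNormEssSup_le_of_ae_enorm_bound (ae_of_all _ fun x => ?_)
    refine iSup_le fun j => (Set.indicator_le_self _ _ x).trans (le_iSup a j)
  · have hr : 0 < p.toReal := ENNReal.toReal_pos hp.ne' hp'
    rw [eLpNorm_eq_lintegral_rpow_enorm_toReal hp.ne' hp', ellNorm, if_neg hp',
      ENNReal.toReal_inv, one_div, ← ENNReal.mul_rpow_of_nonneg _ _ (by positivity)]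
    gcongr
    simp only [enorm_eq_self]
    calc ∫⁻ x, stepSup B a x ^ p.toReal ∂μ
        ≤ ∫⁻ x, ∑' j, (B j).indicator (fun _ => a j ^ p.toReal) x ∂μ := by
          refine lintegral_mono fun x => ?_
          rw [← ENNReal.le_rpow_inv_iff hr]
          refine iSup_le fun j => ?_
          rw [ENNReal.le_rpow_inv_iff hr]
          refine le_trans ?_ (ENNReal.le_tsum j)
          by_cases hx : x ∈ B j
          · simp [hx]
          · simp [hx, hr]
      _ = V * ∑' j, a j ^ p.toReal := by
          rw [lintegral_tsum fun j => (measurable_const.indicator (hB j)).aemeasurable,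
            ← ENNReal.tsum_mul_left]
          refine tsum_congr fun j => ?_
          rw [lintegral_indicator_const (hB j), hV, mul_comm]

end Discretization

/-! ### Balls of the control distance -/

section Balls

variable {E F : Type*} [NormedAddCommGroup E] [InnerProductSpace ℂ E] [FiniteDimensional ℂ E]
  [NormedAddCommGroup F] [InnerProductSpace ℝ F] (Φ : HermitianMap E F)

lemma ctrlDist_le_homNorm (z w : E × F) : ctrlDist Φ z w ≤ homNorm (nMul Φ (nInv z) w) := by
  have h := ctrlDist_nMul_le_homNorm Φ z (nMul Φ (nInv z) w)
  rwa [nMul_nInv_nMul] at h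

lemma ctrlDist_self_le (z : E × F) : ctrlDist Φ z z ≤ 0 := by
  refine (ctrlDist_le_homNorm Φ z z).trans (le_of_eq ?_)
  rw [(nMul_group Φ).2.2]
  simp [homNorm]

/-- Two points of a homogeneous ball of radius `r ≤ r₀` differ by a group element of norm `O(r)`. -/
lemma norm_nInv_nMul_le_of_homNorm_le {r r₀ : ℝ} (hr : r ≤ r₀) {x w z : E × F}
    (hw : homNorm (nMul Φ (nInv x) w) ≤ r) (hz : homNorm (nMul Φ (nInv x) z) ≤ r) :
    ‖nMul Φ (nInv w) z‖ ≤ (2 + 2 * ctrlConst Φ * r₀) * r := by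
  have hC := one_le_ctrlConst Φ
  have hr0 : 0 ≤ r := (homNorm_nonneg _).trans hw
  set h := nMul Φ (nInv x) w with hh
  set h' := nMul Φ (nInv x) z with hh'
  have heq : nMul Φ (nInv w) z = nMul Φ (nInv h) h' := by
    rw [← nMul_nInv_nMul Φ x w, ← nMul_nInv_nMul Φ x z, ← hh, ← hh', nInv_nMul, nMul_assoc,
      nInv_nMul_nMul]
  have h1 : ‖h.1‖ ≤ r := (le_max_left _ _).trans hw
  have h2 : ‖h'.1‖ ≤ r := (le_max_left _ _).trans hz
  have h3 : ‖h.2‖ ≤ r ^ 2 := (Real.sqrt_le_left hr0).1 ((le_max_right _ _).trans hw)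
  have h4 : ‖h'.2‖ ≤ r ^ 2 := (Real.sqrt_le_left hr0).1 ((le_max_right _ _).trans hz)
  have h5 := Φ.norm_im_le (-h.1) h'.1
  rw [norm_neg] at h5
  have h6 : ‖Φ.imCLM‖ * ‖h.1‖ * ‖h'.1‖ ≤ ‖Φ.imCLM‖ * r * r := by gcongr
  have h7 : 2 * ctrlConst Φ * r ^ 2 ≤ 2 * ctrlConst Φ * (r₀ * r) := by
    gcongr; nlinarith
  have h8 : 2 * ctrlConst Φ * r ^ 2 = 2 * r ^ 2 + 4 * (‖Φ.imCLM‖ * r * r) := by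
    rw [ctrlConst]; ring
  have h9 : 0 ≤ ‖Φ.imCLM‖ * r * r := by positivity
  have h10 : 0 ≤ 2 * ctrlConst Φ * r ^ 2 := by positivity
  rw [heq, Prod.norm_def]
  refine max_le ?_ ?_
  · calc ‖-h.1 + h'.1‖ ≤ ‖-h.1‖ + ‖h'.1‖ := norm_add_le _ _
      _ = ‖h.1‖ + ‖h'.1‖ := by rw [norm_neg]
      _ ≤ _ := by linarith
  · calc ‖-h.2 + h'.2 + (2 : ℝ) • Φ.im (-h.1) h'.1‖
        ≤ ‖-h.2‖ + ‖h'.2‖ + ‖(2 : ℝ) • Φ.im (-h.1) h'.1‖ := norm_add₃_le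
      _ = ‖h.2‖ + ‖h'.2‖ + 2 * ‖Φ.im (-h.1) h'.1‖ := by rw [norm_smul, norm_neg]; norm_num
      _ ≤ _ := by linarith

end Balls

lemma ofReal_one_div_mul_le {a b K : ℝ≥0∞} {C : ℝ} (hC : 0 < C) (hK : K ≤ ENNReal.ofReal C)
    (h : a ≤ K * b) : ENNReal.ofReal (1 / C) * a ≤ b := by
  have hC0 : ENNReal.ofReal C ≠ 0 := by simpa using hC
  rw [one_div, ENNReal.ofReal_inv_of_pos hC, mul_comm, ← div_eq_mul_inv,
    ENNReal.div_le_iff hC0 ENNReal.ofReal_ne_top, mul_comm]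
  exact h.trans (by gcongr)

/-! ### Sampling -/

section Sampling

variable {E F : Type*} [NormedAddCommGroup E] [InnerProductSpace ℂ E] [FiniteDimensional ℂ E]
  [MeasurableSpace E] [BorelSpace E]
  [NormedAddCommGroup F] [InnerProductSpace ℝ F] [FiniteDimensional ℝ F]
  [MeasurableSpace F] [BorelSpace F]
  (Φ : HermitianMap E F) (μ : Measure (E × F)) [μ.IsAddHaarMeasure]

lemma measure_homBall_rpow (x : E × F) {c δ : ℝ} (hc : 0 < c) (hδ : 0 < δ) (Q : ℕ)
    (hQ : Q = Module.finrank ℂ E + Module.finrank ℝ F) (s : ℝ) (hs : 0 ≤ s) :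
    μ (homBall Φ x (c * δ)) ^ s =
      (ENNReal.ofReal (c ^ (2 * (Q : ℝ))) * μ {h | homNorm h < 1}) ^ s *
        ENNReal.ofReal (δ ^ (2 * (Q : ℝ) * s)) := by
  rw [measure_homBall Φ μ x (mul_pos hc hδ), ← hQ, Real.mul_rpow hc.le hδ.le,
    ENNReal.ofReal_mul (by positivity), mul_right_comm, ENNReal.mul_rpow_of_nonneg _ _ hs,
    ENNReal.ofReal_rpow_of_nonneg (by positivity) hs, ← Real.rpow_mul hδ.le]

/-- The sampling estimates for a given lattice, with a measurable function `H` which dominates `f`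
and its oscillations: the lower bound for the maxima, the upper bound for the maxima, and the lower
bound for the minima up to an error of size `δ`. -/
lemma sampling_estimates {p : ℝ≥0∞} (hp : 0 < p) {δplus R₀ : ℝ} (hR₀ : 1 < R₀) (Q : ℕ)
    (hQ : Q = Module.finrank ℂ E + Module.finrank ℝ F)
    {J : Type*} {z : J → E × F} {δ R : ℝ} (hδ : 0 < δ) (hδ' : δ ≤ δplus)
    (hRR : R ≤ R₀) (hz : IsLattice (ctrlDist Φ) δ R z) {f : E × F → ℂ} {H : E × F → ℝ≥0∞}
    (hH : Measurable H) {C κ ρ : NNReal}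
    (hκ : (κ : ℝ) = (2 + 2 * ctrlConst Φ * (ctrlConst Φ * R₀ * δplus)) * (ctrlConst Φ * R₀))
    (hρ : (ρ : ℝ) = κ * δplus)
    (hdom : ∀ w y, ‖nMul Φ (nInv w) y‖ ≤ ρ → ‖f w‖ₑ ≤ C * H y)
    (hosc : ∀ w g, ‖g‖ ≤ ρ → ‖f (nMul Φ w g) - f w‖ₑ ≤ C * ENNReal.ofReal ‖g‖ * H w) :
    eLpNorm f p μ ≤ (ENNReal.ofReal ((2 * ctrlConst Φ * R₀) ^ (2 * (Q : ℝ))) *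
        μ {h : E × F | homNorm h < 1}) ^ p⁻¹.toReal *
      (ENNReal.ofReal (δ ^ (2 * (Q : ℝ) * p⁻¹.toReal)) *
        ellNorm p fun j => ballMax (ctrlDist Φ) f (z j) (R * δ)) ∧
    μ {h : E × F | homNorm h < 1} ^ p⁻¹.toReal *
      (ENNReal.ofReal (δ ^ (2 * (Q : ℝ) * p⁻¹.toReal)) *
        ellNorm p fun j => ballMax (ctrlDist Φ) f (z j) (R * δ)) ≤ C * eLpNorm H p μ ∧
    eLpNorm f p μ ≤ p.LpAddConst * ((ENNReal.ofReal ((2 * ctrlConst Φ * R₀) ^ (2 * (Q : ℝ))) *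
        μ {h : E × F | homNorm h < 1}) ^ p⁻¹.toReal *
      (ENNReal.ofReal (δ ^ (2 * (Q : ℝ) * p⁻¹.toReal)) *
        ellNorm p fun j => ballMin (ctrlDist Φ) f (z j) (R * δ)) +
      C * κ * ENNReal.ofReal δ * eLpNorm H p μ) := by
  have hA := one_le_ctrlConst Φ
  set A := ctrlConst Φ
  set s := p⁻¹.toReal with hs
  have hs0 : 0 ≤ s := ENNReal.toReal_nonneg
  set r := A * R₀ * δ with hr
  have hr0 : 0 < r := by positivity
  have hδr : δ ≤ r := by
    rw [hr]; nlinarith [mul_le_mul hA hR₀.le zero_le_one (by linarith : (0 : ℝ) ≤ A)]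
  have hrr : r ≤ A * R₀ * δplus := by rw [hr]; gcongr
  have hball : ∀ {x y}, ctrlDist Φ x y ≤ R * δ → homNorm (nMul Φ (nInv x) y) ≤ r := by
    intro x y h
    refine (homNorm_le_ctrlDist Φ x y).trans ?_
    calc A * ctrlDist Φ x y ≤ A * (R₀ * δ) := by
          gcongr
          exact h.trans (by gcongr)
      _ = r := by rw [hr]; ring
  have hκr : ∀ {x w y}, homNorm (nMul Φ (nInv x) w) ≤ r → homNorm (nMul Φ (nInv x) y) ≤ r →
      ‖nMul Φ (nInv w) y‖ ≤ κ * δ := by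
    intro x w y hw hy
    refine (norm_nInv_nMul_le_of_homNorm_le Φ hrr hw hy).trans (le_of_eq ?_)
    rw [hκ, hr]; ring
  have hκρ : (κ : ℝ) * δ ≤ ρ := by rw [hρ]; gcongr
  -- Disjoint homogeneous balls inside the balls of the lattice; their openness makes `J` countable.
  have hd : Pairwise fun j k => Disjoint (homBall Φ (z j) δ) (homBall Φ (z k) δ) := by
    intro j k hjk
    exact (hz.1 hjk).mono (fun y hy => (ctrlDist_le_homNorm Φ _ _).trans_lt hy)
      (fun y hy => (ctrlDist_le_homNorm Φ _ _).trans_lt hy)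
  have : FiniteDimensional ℝ E := FiniteDimensional.complexToReal E
  have : Countable J := Pairwise.countable_of_isOpen_disjoint hd
    (fun j => isOpen_homBall Φ _ _) (fun j => ⟨z j, mem_homBall_self Φ _ hδ⟩)
  have hV₁ : ∀ j, μ (homBall Φ (z j) δ) = μ (homBall Φ 0 δ) := fun j => by
    rw [measure_homBall Φ μ _ hδ, measure_homBall Φ μ _ hδ]
  -- Larger homogeneous balls, which cover the group and contain the closed balls of the lattice.
  have hV₂ : ∀ j, μ (homBall Φ (z j) (2 * r)) = μ (homBall Φ 0 (2 * r)) := fun j => by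
    rw [measure_homBall Φ μ _ (by positivity), measure_homBall Φ μ _ (by positivity)]
  have hmeas : ∀ (t : ℝ) j, MeasurableSet (homBall Φ (z j) t) := fun t j =>
    (isOpen_homBall Φ _ _).measurableSet
  have hc₁ := measure_homBall_rpow Φ μ 0 one_pos hδ Q hQ s hs0
  rw [one_mul, Real.one_rpow, ENNReal.ofReal_one, one_mul] at hc₁
  have hc₂ := measure_homBall_rpow Φ μ 0 (c := 2 * A * R₀) (by positivity) hδ Q hQ s hs0
  rw [show 2 * A * R₀ * δ = 2 * r by rw [hr]; ring] at hc₂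
  have hmem : ∀ {j y}, ctrlDist Φ (z j) y < R * δ → y ∈ homBall Φ (z j) (2 * r) := fun h =>
    (hball h.le).trans_lt (by linarith)
  refine ⟨?_, ?_, ?_⟩
  · rw [← mul_assoc, ← hc₂]
    refine le_trans ?_ (eLpNorm_stepSup_le hp (hmeas (2 * r)) hV₂ _)
    refine eLpNorm_mono_enorm fun y => ?_
    obtain ⟨j, hj⟩ := hz.2 y
    rw [enorm_eq_self]
    refine le_trans ?_ (le_stepSup _ (hmem hj))
    exact le_iSup₂ (f := fun w (_ : w ∈ {w | ctrlDist Φ (z j) w ≤ R * δ}) => ‖f w‖ₑ) y hj.le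
  · rw [← mul_assoc, ← hc₁]
    have hV0 : μ (homBall Φ 0 δ) ≠ 0 :=
      ((isOpen_homBall Φ 0 δ).measure_pos μ ⟨0, mem_homBall_self Φ 0 hδ⟩).ne'
    refine (ellNorm_le_eLpNorm (g := fun y => C * H y) hp (hmeas δ) hd hV0 hV₁
      fun j y hy => ?_).trans
      (eLpNorm_le_mul_eLpNorm_of_ae_le_mul' (ae_of_all _ fun y => le_rfl) p)
    refine iSup₂_le fun w hw => hdom w y ?_
    exact (hκr (hball hw) (le_of_lt (lt_of_lt_of_le hy hδr))).trans hκρ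
  · rw [← mul_assoc (_ ^ s), ← hc₂]
    set a : J → ℝ≥0∞ := fun j => ballMin (ctrlDist Φ) f (z j) (R * δ)
    set c : NNReal := C * κ * δ.toNNReal with hc
    have hcc : (C * κ * ENNReal.ofReal δ : ℝ≥0∞) = c := by
      rw [hc]; push_cast; rfl
    rw [hcc]
    have hpt : ∀ y, ‖f y‖ₑ ≤ stepSup (fun j => homBall Φ (z j) (2 * r)) a y + c * H y := by
      -- On a ball of the lattice, `|f y|` exceeds every `|f w|` at most by the oscillation.
      intro y
      obtain ⟨j, hj⟩ := hz.2 y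
      refine le_trans ?_ (add_le_add_left (le_stepSup a (hmem hj)) _)
      rw [← tsub_le_iff_right]
      refine le_iInf₂ fun w hw => ?_
      rw [tsub_le_iff_right]
      have hg := hκr (hball hj.le) (hball hw)
      have h1 := hosc y (nMul Φ (nInv y) w) (hg.trans hκρ)
      rw [nMul_nInv_nMul] at h1
      have h2 : ‖f y‖ₑ ≤ ‖f w‖ₑ + ‖f w - f y‖ₑ := by
        have h3 := enorm_sub_le (a := f w) (b := f w - f y)
        rwa [sub_sub_cancel] at h3
      refine h2.trans (add_le_add_right (h1.trans ?_) _)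
      refine mul_le_mul_left ?_ _
      rw [← hcc, mul_assoc]
      refine mul_le_mul_right ?_ _
      rw [← ENNReal.ofReal_coe_nnreal, ← ENNReal.ofReal_mul κ.coe_nonneg]
      exact ENNReal.ofReal_le_ofReal hg
    have hm := measurable_stepSup (hmeas (2 * r)) a
    calc eLpNorm f p μ
        ≤ eLpNorm (stepSup (fun j => homBall Φ (z j) (2 * r)) a + fun y => c * H y) p μ :=
          eLpNorm_mono_enorm fun y => by simpa using hpt y
      _ ≤ p.LpAddConst * (eLpNorm (stepSup (fun j => homBall Φ (z j) (2 * r)) a) p μ +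
          eLpNorm (fun y => c * H y) p μ) :=
          eLpNorm_add_le' hm.aestronglyMeasurable (hH.const_mul _).aestronglyMeasurable p
      _ ≤ _ := by
          gcongr
          · exact eLpNorm_stepSup_le hp (hmeas (2 * r)) hV₂ a
          · exact eLpNorm_le_mul_eLpNorm_of_ae_le_mul' (ae_of_all _ fun y => le_rfl) p

end Sampling

end Sampling

theorem mainTheorem6
    {E F : Type*} [NormedAddCommGroup E] [InnerProductSpace ℂ E] [FiniteDimensional ℂ E]
    [MeasurableSpace E] [BorelSpace E]
    [NormedAddCommGroup F] [InnerProductSpace ℝ F] [FiniteDimensional ℝ F]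
    [MeasurableSpace F] [BorelSpace F]
    (Φ : Sampling.HermitianMap E F)
    (μ : Measure (E × F)) [μ.IsAddHaarMeasure]
    (φ : 𝓢(E × F, ℂ)) (p : ℝ≥0∞) (hp : 0 < p)
    (δplus R₀ : ℝ) (hδplus : 0 < δplus) (hR₀ : 1 < R₀)
    (Q : ℕ) (hQ : Q = Module.finrank ℂ E + Module.finrank ℝ F) :
    ∃ C δminus : ℝ, 0 < C ∧ 0 < δminus ∧
      ∀ (J : Type*) (z : J → E × F) (δ R : ℝ), 0 < δ → 1 < R → R ≤ R₀ →
        Sampling.IsLattice (Sampling.ctrlDist Φ) δ R z →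
        ∀ u ∈ Sampling.spaceO Φ μ φ,
          (δ ≤ δplus →
            ENNReal.ofReal (1 / C) * eLpNorm (Sampling.conv Φ u φ) p μ ≤
              ENNReal.ofReal (δ ^ (2 * (Q : ℝ) * p⁻¹.toReal)) *
                Sampling.ellNorm p (fun j =>
                  Sampling.ballMax (Sampling.ctrlDist Φ) (Sampling.conv Φ u φ) (z j) (R * δ)) ∧
            ENNReal.ofReal (δ ^ (2 * (Q : ℝ) * p⁻¹.toReal)) *
                Sampling.ellNorm p (fun j =>
                  Sampling.ballMax (Sampling.ctrlDist Φ) (Sampling.conv Φ u φ) (z j) (R * δ)) ≤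
              ENNReal.ofReal C * eLpNorm (Sampling.conv Φ u φ) p μ) ∧
          (δ ≤ δminus → u ∈ Sampling.spaceOp Φ μ φ p →
            ENNReal.ofReal (1 / C) * eLpNorm (Sampling.conv Φ u φ) p μ ≤
              ENNReal.ofReal (δ ^ (2 * (Q : ℝ) * p⁻¹.toReal)) *
                Sampling.ellNorm p (fun j =>
                  Sampling.ballMin (Sampling.ctrlDist Φ) (Sampling.conv Φ u φ) (z j) (R * δ)) ∧
            ENNReal.ofReal (δ ^ (2 * (Q : ℝ) * p⁻¹.toReal)) *
                Sampling.ellNorm p (fun j =>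
                  Sampling.ballMin (Sampling.ctrlDist Φ) (Sampling.conv Φ u φ) (z j) (R * δ)) ≤
              ENNReal.ofReal C * eLpNorm (Sampling.conv Φ u φ) p μ) := by
  have hA := Sampling.one_le_ctrlConst Φ
  set A := Sampling.ctrlConst Φ with hA'
  let κ : NNReal := ((2 + 2 * A * (A * R₀ * δplus)) * (A * R₀)).toNNReal
  have hκ : (κ : ℝ) = (2 + 2 * A * (A * R₀ * δplus)) * (A * R₀) :=
    Real.coe_toNNReal _ (by positivity)
  let ρ : NNReal := (κ * δplus).toNNReal
  have hρ : (ρ : ℝ) = κ * δplus := Real.coe_toNNReal _ (by positivity)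
  obtain ⟨C₀, h₀⟩ := Sampling.exists_dominating Φ μ φ hp ρ.2
  set v := μ {h : E × F | Sampling.homNorm h < 1} with hv
  have hv0 : v ≠ 0 := Sampling.measure_homNorm_lt_one_ne_zero μ
  have hv1 : v ≠ ∞ := Sampling.measure_homNorm_lt_one_ne_top μ
  set s := p⁻¹.toReal with hs
  have hs0 : 0 ≤ s := ENNReal.toReal_nonneg
  set K₁ := (ENNReal.ofReal ((2 * A * R₀) ^ (2 * (Q : ℝ))) * v) ^ s with hK₁
  have hK₁t : K₁ ≠ ∞ := ENNReal.rpow_ne_top_of_nonneg hs0 (ENNReal.mul_ne_top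
    ENNReal.ofReal_ne_top hv1)
  have hvs0 : v ^ s ≠ 0 := by simp [ENNReal.rpow_eq_zero_iff, hv0, hv1]
  have hvs1 : v ^ s ≠ ∞ := ENNReal.rpow_ne_top_of_nonneg hs0 hv1
  have hL : p.LpAddConst ≠ ∞ := (ENNReal.LpAddConst_lt_top p).ne
  set K₂ : ℝ≥0∞ := (v ^ s)⁻¹ * (C₀ * C₀) with hK₂
  have hK₂t : K₂ ≠ ∞ := ENNReal.mul_ne_top (ENNReal.inv_ne_top.2 hvs0)
    (ENNReal.mul_ne_top ENNReal.coe_ne_top ENNReal.coe_ne_top)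
  set K₃ : ℝ≥0∞ := 2 * (p.LpAddConst * K₁) with hK₃
  have hK₃t : K₃ ≠ ∞ := ENNReal.mul_ne_top ENNReal.ofNat_ne_top (ENNReal.mul_ne_top hL hK₁t)
  have hKt : K₁ + K₂ + K₃ ≠ ∞ := ENNReal.add_ne_top.2 ⟨ENNReal.add_ne_top.2 ⟨hK₁t, hK₂t⟩, hK₃t⟩
  -- `e δ` is the factor of `‖u‖` in the error term of the lower bound for the minima.
  set e : ℝ≥0∞ := p.LpAddConst * (C₀ * κ * C₀) with he
  have het : e ≠ ∞ := ENNReal.mul_ne_top hL (ENNReal.mul_ne_top (ENNReal.mul_ne_top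
    ENNReal.coe_ne_top ENNReal.coe_ne_top) ENNReal.coe_ne_top)
  set C := (K₁ + K₂ + K₃).toReal + 1 with hC
  have hC0 : 0 < C := by positivity
  have hCK : K₁ + K₂ + K₃ ≤ ENNReal.ofReal C := by
    rw [← ENNReal.ofReal_toReal hKt]
    exact ENNReal.ofReal_le_ofReal (by linarith)
  have hCK₁ : K₁ ≤ ENNReal.ofReal C := (le_self_add.trans le_self_add).trans hCK
  have hCK₂ : K₂ ≤ ENNReal.ofReal C := (le_add_self.trans le_self_add).trans hCK
  have hCK₃ : K₃ ≤ ENNReal.ofReal C := le_add_self.trans hCK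
  refine ⟨C, min δplus (1 / (2 * (e.toReal + 1))), hC0, by positivity, ?_⟩
  intro J z δ R hδ hR hRR hz u hu
  obtain ⟨H, hHm, hHn, hdom, hosc⟩ := h₀ u hu
  have hmain : δ ≤ δplus → _ := fun hδ' => Sampling.sampling_estimates Φ μ hp hR₀ Q hQ hδ hδ'
    hRR hz hHm hκ hρ hdom hosc
  have hmax : δ ≤ δplus → ENNReal.ofReal (δ ^ (2 * (Q : ℝ) * s)) *
      Sampling.ellNorm p (fun j =>
        Sampling.ballMax (Sampling.ctrlDist Φ) (Sampling.conv Φ u φ) (z j) (R * δ)) ≤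
      ENNReal.ofReal C * eLpNorm (Sampling.conv Φ u φ) p μ := by
    intro hδ'
    have h2 := (hmain hδ').2.1
    rw [mul_comm, ← ENNReal.le_div_iff_mul_le (Or.inl hvs0) (Or.inl hvs1)] at h2
    calc _ ≤ C₀ * eLpNorm H p μ / v ^ s := h2
      _ ≤ C₀ * (C₀ * eLpNorm (Sampling.conv Φ u φ) p μ) / v ^ s := by gcongr
      _ = K₂ * eLpNorm (Sampling.conv Φ u φ) p μ := by rw [hK₂, div_eq_mul_inv]; ring
      _ ≤ _ := by gcongr
  refine ⟨fun hδ' => ⟨?_, hmax hδ'⟩, fun hδm hup => ?_⟩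
  · exact Sampling.ofReal_one_div_mul_le hC0 hCK₁ (hmain hδ').1
  · have hδ' : δ ≤ δplus := hδm.trans (min_le_left _ _)
    refine ⟨?_, ?_⟩
    · refine Sampling.ofReal_one_div_mul_le hC0 hCK₃ ?_
      have h3 := (hmain hδ').2.2
      set S := ENNReal.ofReal (δ ^ (2 * (Q : ℝ) * s)) * Sampling.ellNorm p (fun j =>
        Sampling.ballMin (Sampling.ctrlDist Φ) (Sampling.conv Φ u φ) (z j) (R * δ))
      set n := eLpNorm (Sampling.conv Φ u φ) p μ with hn
      have hnt : n ≠ ∞ := hup.2.2.ne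
      -- For small `δ` the error term is absorbed, as the norm of `u` is finite
      have hsmall : e * ENNReal.ofReal δ ≤ 2⁻¹ := by
        have h4 : δ ≤ 1 / (2 * (e.toReal + 1)) := hδm.trans (min_le_right _ _)
        have he0 : 0 ≤ e.toReal := ENNReal.toReal_nonneg
        rw [le_div_iff₀ (by positivity)] at h4
        rw [← ENNReal.ofReal_toReal het, ← ENNReal.ofReal_mul he0,
          show (2⁻¹ : ℝ≥0∞) = ENNReal.ofReal 2⁻¹ by
            rw [ENNReal.ofReal_inv_of_pos two_pos, ENNReal.ofReal_ofNat]]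
        refine ENNReal.ofReal_le_ofReal ?_
        nlinarith
      have h5 : n ≤ p.LpAddConst * K₁ * S + 2⁻¹ * n := by
        calc n ≤ p.LpAddConst * (K₁ * S + C₀ * κ * ENNReal.ofReal δ * eLpNorm H p μ) := h3
          _ ≤ p.LpAddConst * (K₁ * S + C₀ * κ * ENNReal.ofReal δ * (C₀ * n)) := by gcongr
          _ = p.LpAddConst * K₁ * S + e * ENNReal.ofReal δ * n := by rw [he]; ring
          _ ≤ _ := by gcongr
      have h6 : 2⁻¹ * n + 2⁻¹ * n = n := by
        rw [← add_mul, ENNReal.inv_two_add_inv_two, one_mul]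
      have h7 : 2⁻¹ * n ≤ p.LpAddConst * K₁ * S := by
        have h8 : 2⁻¹ * n ≠ ∞ := ENNReal.mul_ne_top (by simp) hnt
        rw [← ENNReal.add_le_add_iff_right h8, h6]
        exact h5
      calc n = 2 * (2⁻¹ * n) := by
            rw [← mul_assoc, ENNReal.mul_inv_cancel two_ne_zero ENNReal.ofNat_ne_top, one_mul]
        _ ≤ 2 * (p.LpAddConst * K₁ * S) := by gcongr
        _ = K₃ * S := by rw [hK₃]; ring
    · refine le_trans ?_ (hmax hδ')
      gcongr
      refine Sampling.ellNorm_mono fun j => ?_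
      have hmem : Sampling.ctrlDist Φ (z j) (z j) ≤ R * δ :=
        (Sampling.ctrlDist_self_le Φ (z j)).trans (by positivity)
      exact (iInf₂_le (z j) hmem).trans (le_iSup₂ (f := fun w
        (_ : w ∈ {w | Sampling.ctrlDist Φ (z j) w ≤ R * δ}) => ‖Sampling.conv Φ u φ w‖ₑ) (z j) hmem)
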